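/- **Conventions.** Let $\bar t=t^{-1}$. A *string link* $T$ on $n$ strands is a class, up to isotopy and Reidemeister moves, of oriented tangle diagrams in $\mathbb R\times[0,1]$ with $n$ endpoints at the bottom and $n$ at the top, all strands pointing upwards at all these endpoints, each of whose components is an interval starting at a bottom endpoint and ending at a top endpoint (so there are no closed components). An *admissible path* in a diagram of $T$ follows the orientation of the diagram, starting at a bottom endpoint and ending at a top endpoint. At a crossing it must go straight on if it arrives along the under-strand; if it arrives along the over-strand it may either go straight on or drop to the under-strand and continue along it in its direction. The weight $w(P)$ of an admissible path $P$ is the product, over the crossings it passes (with repetitions), of the factors: $1$ when arriving along the under-strand; when arriving along the over-strand of a positive crossing, $t$ for going straight and $1-t$ for dropping; when arriving along the over-strand of a negative crossing, $\bar t$ for going straight and $1-\bar t$ for dropping. The *random walk matrix* $\gamma_n(T)$ is the $n\times n$ matrix over the field $\mathbb Q(t)$ of rational functions such that, for every diagram of $T$ and all complex $t$ sufficiently close to $1$, for all $i,j$ the sum $\sum_P w(P)$ over all admissible paths $P$ from the $i$-th bottom endpoint to the $j$-th top endpoint converges unconditionally to the value at $t$ of the entry $\gamma_n(T)_{j,i}$.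 The *Burau representation* of the braid group $B_N$ (generators $\sigma_1,\dots,\sigma_{N-1}$, relations $\sigma_i\sigma_{i+1}\sigma_i=\sigma_{i+1}\sigma_i\sigma_{i+1}$, and $\sigma_i\sigma_j=\sigma_j\sigma_i$ for $|i-j|\ge 2$) is the homomorphism to $\mathrm{GL}_N(\mathbb Z[t,t^{-1}])$ with $$\sigma_i\mapsto \mathbf 1_{i-1}\oplus\begin{bmatrix}1-t&1\\ t&0\end{bmatrix}\oplus\mathbf 1_{N-i-1}.$$ Here $\sigma_i$ is drawn, with all strands oriented upwards, as a positive crossing of the $i$-th and $(i+1)$-st strands, the over-strand running from bottom left to top right, and $bb'$ is $b$ stacked on top of $b'$. The *partial closure* of $b\in B_{n+m}$ is the tangle obtained by joining the top and bottom endpoints of each of the last $m$ strands by nested arcs passing to the right of $b$. **Proposition.** Let $n,m\ge 0$, let $b\in B_{n+m}$, and let $T$ be a string link on $n$ strands that is the partial closure of $b$. Write the Burau matrix of $b$ in block form $$\begin{bmatrix}X&Y\\ Z&Q\end{bmatrix}$$ with $X$ of size $n\times n$ and $Q$ of size $m\times m$. Then $\mathbf 1-Q$ is invertible over $\mathbb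 Q(t)$, the random walk matrix $\gamma_n(T)$ is well defined, and $$\gamma_n(T)=X+Y(\mathbf 1-Q)^{-1}Z .$$ In particular, for every diagram of $T$ the path sums above converge, for $t$ sufficiently close to $1$, to the values of the entries of $X+Y(\mathbf 1-Q)^{-1}Z$. -/

import Mathlib

namespace RandomWalk

open Filter Topology
open scoped LaurentPolynomial

/-! ### Oriented tangle diagrams

Signs are Booleans: `true` is `+` (strand oriented upwards), `false` is `-`. -/

/-- The elementary pieces of an oriented tangle diagram in Morse position.
* `cup b` is a local minimum creating two strand ends with signs `b, !b`;
* `cap b` is a local maximum joining two strand ends with signs `b, !b`;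
* `cross a b o` is a crossing of the strand of sign `a` running between bottom left and top right
  with the strand of sign `b` running between bottom right and top left; the former is the
  over-strand iff `o = true`. -/
inductive Gen : Type
  | cup (b : Bool)
  | cap (b : Bool)
  | cross (a b o : Bool)

/-- Signs at the bottom of an elementary piece. -/
def Gen.dom : Gen → List Bool
  | .cup _ => []
  | .cap b => [b, !b]
  | .cross a b _ => [a, b]

/-- Signs at the top of an elementary piece. -/
def Gen.cod : Gen → List Bool
  | .cup b => [b, !b]
  | .cap _ => []
  | .cross a b _ => [b, a]

/-- A horizontal slice of a diagram: one elementary piece, with vertical strands of the given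
signs to its left and to its right. -/
structure Slice : Type where
  left : List Bool
  gen : Gen
  right : List Bool

def Slice.dom (s : Slice) : List Bool := s.left ++ s.gen.dom ++ s.right

def Slice.cod (s : Slice) : List Bool := s.left ++ s.gen.cod ++ s.right

/-- Adding further vertical strands on both sides of a slice. -/
def Slice.whisker (l r : List Bool) (s : Slice) : Slice := ⟨l ++ s.left, s.gen, s.right ++ r⟩

/-- A list of slices (from bottom to top) can be stacked to a diagram from the signs `ε` at the
bottom to the signs `δ` at the top. -/
def Composable : List Bool → List Slice → List Bool → Prop
  | ε, [], δ => ε = δ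
  | ε, s :: w, δ => s.dom = ε ∧ Composable s.cod w δ

/-- An oriented tangle diagram in Morse position, from `ε` (bottom) to `δ` (top), cut into
elementary slices listed from bottom to top. -/
structure TangleDiagram (ε δ : List Bool) : Type where
  word : List Slice
  composable : Composable ε word δ

/-- The local moves: planar isotopy (exchange of heights of two distant pieces, cancellation of a
minimum and a maximum, sliding a strand past a maximum or minimum) and the Reidemeister moves,
for all orientations. -/
inductive LocalMove : List Slice → List Slice → Prop
  /-- Exchange of heights of two distant pieces, `mid` being the strands between them. -/
  | exchange (g h : Gen) (mid : List Bool) :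
      LocalMove [⟨[], g, mid ++ h.dom⟩, ⟨g.cod ++ mid, h, []⟩]
        [⟨g.dom ++ mid, h, []⟩, ⟨[], g, mid ++ h.cod⟩]
  | zigzagRight (a : Bool) :
      LocalMove [⟨[a], .cup (!a), []⟩, ⟨[], .cap a, [a]⟩] []
  | zigzagLeft (a : Bool) :
      LocalMove [⟨[], .cup a, [a]⟩, ⟨[a], .cap (!a), []⟩] []
  /-- A strand `c` slides over or under a maximum. -/
  | slideCap (a c o : Bool) :
      LocalMove [⟨[], .cross a c o, [!a]⟩, ⟨[c], .cap a, []⟩]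
        [⟨[a], .cross c (!a) (!o), []⟩, ⟨[], .cap a, [c]⟩]
  /-- A strand `c` slides over or under a minimum. -/
  | slideCup (a c o : Bool) :
      LocalMove [⟨[c], .cup a, []⟩, ⟨[], .cross c a o, [!a]⟩]
        [⟨[], .cup a, [c]⟩, ⟨[a], .cross (!a) c (!o), []⟩]
  /-- First Reidemeister move, at a maximum. -/
  | reidemeister1Cap (a o : Bool) :
      LocalMove [⟨[], .cross a (!a) o, []⟩, ⟨[], .cap (!a), []⟩] [⟨[], .cap a, []⟩]
  /-- First Reidemeister move, at a minimum. -/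
  | reidemeister1Cup (a o : Bool) :
      LocalMove [⟨[], .cup a, []⟩, ⟨[], .cross a (!a) o, []⟩] [⟨[], .cup (!a), []⟩]
  | reidemeister2 (a c o : Bool) :
      LocalMove [⟨[], .cross a c o, []⟩, ⟨[], .cross c a (!o), []⟩] []
  /-- Third Reidemeister move; `o₁`, `o₂`, `o₃` say which strand is over in the pairs `a b`, `a c`,
  `b c`. The hypothesis excludes the two cyclic patterns, in which the strands are not stacked. -/
  | reidemeister3 (a b c o₁ o₂ o₃ : Bool) (h : o₁ = o₂ ∨ o₂ = o₃) :
      LocalMove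
        [⟨[], .cross a b o₁, [c]⟩, ⟨[b], .cross a c o₂, []⟩, ⟨[], .cross b c o₃, [a]⟩]
        [⟨[a], .cross b c o₃, []⟩, ⟨[], .cross a c o₂, [b]⟩, ⟨[c], .cross a b o₁, []⟩]

/-- Two diagrams differ by one local move performed somewhere in the diagram. -/
def TangleDiagram.Move {ε δ : List Bool} (D D' : TangleDiagram ε δ) : Prop :=
  ∃ (lower upper : List Slice) (l r : List Bool) (A B : List Slice), LocalMove A B ∧
    D.word = lower ++ A.map (Slice.whisker l r) ++ upper ∧
    D'.word = lower ++ B.map (Slice.whisker l r) ++ upper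

/-- Oriented tangles: oriented tangle diagrams up to the equivalence relation generated by planar
isotopy and Reidemeister moves. -/
def Tangle (ε δ : List Bool) : Type := Quot (TangleDiagram.Move (ε := ε) (δ := δ))

/-- The tangle represented by a diagram. -/
def TangleDiagram.toTangle {ε δ : List Bool} (D : TangleDiagram ε δ) : Tangle ε δ :=
  Quot.mk _ D

/-- The object `(+, …, +)` with `n` entries. -/
abbrev pos (n : ℕ) : List Bool := List.replicate n true

/-! ### Walking along a diagram -/

/-- The `p`-th (from the left, starting at `0`) strand end at the bottom or top of a piece. -/
inductive End : Type
  | bot (p : ℕ)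
  | top (p : ℕ)

def End.shift (k : ℕ) : End → End
  | .bot p => .bot (k + p)
  | .top p => .top (k + p)

/-- A strand segment with sign `b` whose ends are `x` and `y`, written as (start, finish): it runs
from `x` to `y` if `b = true` and from `y` to `x` otherwise. -/
def orient (b : Bool) (x y : End) : End × End := if b then (x, y) else (y, x)

/-- What can happen to a walker in one slice: no crossing is met, or a crossing is passed along the
under-strand, or it is passed along the over-strand, or the walker drops from the over-strand to
the under-strand. In the last two cases the sign of the crossing is recorded. -/
inductive Turn : Type
  | free
  | under
  | straight (positive : Bool)
  | drop (positive : Bool)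

/-- The admissible steps through an elementary piece. In a crossing, the sign is positive iff the
over-strand is the one between bottom left and top right and both strands have the same vertical
direction, or neither of these holds. -/
def Gen.IsStep : Gen → End → Turn → End → Prop
  | .cup b, x, τ, y => τ = .free ∧ (x, y) = orient b (.top 1) (.top 0)
  | .cap b, x, τ, y => τ = .free ∧ (x, y) = orient b (.bot 0) (.bot 1)
  | .cross a b o, x, τ, y =>
      let rising := orient a (.bot 0) (.top 1)
      let falling := orient b (.bot 1) (.top 0)
      let overStrand := if o then rising else falling
      let underStrand := if o then falling else rising
      let positive : Bool := o == (a == b)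
      (τ = .under ∧ (x, y) = underStrand) ∨
      (τ = .straight positive ∧ (x, y) = overStrand) ∨
      (τ = .drop positive ∧ (x, y) = (overStrand.1, underStrand.2))

/-- The admissible steps through a slice: along a vertical strand on the left, through the
elementary piece, or along a vertical strand on the right. -/
def Slice.IsStep (s : Slice) (x : End) (τ : Turn) (y : End) : Prop :=
  (∃ p b, s.left[p]? = some b ∧ τ = .free ∧ (x, y) = orient b (.bot p) (.top p)) ∨
  (∃ x' y', s.gen.IsStep x' τ y' ∧ x = x'.shift s.left.length ∧ y = y'.shift s.left.length) ∨
  (∃ p b, s.right[p]? = some b ∧ τ = .free ∧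
    (x, y) = orient b (.bot (s.left.length + s.gen.dom.length + p))
      (.top (s.left.length + s.gen.cod.length + p)))

/-- A point of a diagram on one of the horizontal lines bounding the slices: level `0` is the bottom
line, level `ℓ + 1` is the line on top of the `ℓ`-th slice, and positions on a line are
numbered from the left, starting at `0`. Only those pairs that satisfy `TangleDiagram.IsPoint` lie
on the diagram. -/
@[ext] structure Point {ε δ : List Bool} (D : TangleDiagram ε δ) : Type where
  level : ℕ
  position : ℕ

namespace TangleDiagram

variable {ε δ : List Bool} (D : TangleDiagram ε δ)

/-- The signs on the line of level `ℓ` (empty above the diagram). -/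
def signs (ℓ : ℕ) : List Bool :=
  if ℓ = D.word.length then δ else ((D.word[ℓ]?).map Slice.dom).getD []

/-- The point lies on the diagram. -/
def IsPoint (P : Point D) : Prop := P.position < (D.signs P.level).length

/-- The `p`-th end at the bottom of the diagram. -/
def bottom (p : ℕ) : Point D := ⟨0, p⟩

/-- The `p`-th end at the top of the diagram. -/
def top (p : ℕ) : Point D := ⟨D.word.length, p⟩

/-- An end of the `ℓ`-th slice as a point of the diagram. -/
def pointOfEnd (ℓ : ℕ) : End → Point D
  | .bot p => ⟨ℓ, p⟩
  | .top p => ⟨ℓ + 1, p⟩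

/-- An admissible step of a walker: it traverses one slice, following the orientation. -/
def IsStep (P : Point D) (τ : Turn) (P' : Point D) : Prop :=
  ∃ (ℓ : ℕ) (s : Slice) (x y : End), D.word[ℓ]? = some s ∧ s.IsStep x τ y ∧
    P = D.pointOfEnd ℓ x ∧ P' = D.pointOfEnd ℓ y

/-- A step that stays on the same component of the tangle. -/
def Follows (P P' : Point D) : Prop :=
  ∃ τ : Turn, (∀ positive, τ ≠ .drop positive) ∧ D.IsStep P τ P'

instance : Quiver (Point D) where
  Hom P P' := {τ : Turn // D.IsStep P τ P'}

/-- The admissible paths from one point to another. -/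
abbrev AdmissiblePath (P P' : Point D) : Type := Quiver.Path P P'

end TangleDiagram

/-- The weight of passing a crossing, with `t̄ = t⁻¹` instead of `t` at negative crossings. -/
noncomputable def Turn.weight (t : ℂ) : Turn → ℂ
  | .free => 1
  | .under => 1
  | .straight positive => if positive then t else t⁻¹
  | .drop positive => if positive then 1 - t else 1 - t⁻¹

/-- The weight `w(P)` of an admissible path, evaluated at `t`: the product over its crossings. -/
noncomputable def TangleDiagram.pathWeight {ε δ : List Bool} (D : TangleDiagram ε δ) (t : ℂ)
    {P P' : Point D} (γ : D.AdmissiblePath P P') : ℂ :=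
  Quiver.Path.weight (fun {P P' : Point D} (e : {τ : Turn // D.IsStep P τ P'}) => e.1.weight t) γ

/-- `G` is the random walk matrix of the diagram `D`: for all `t` sufficiently close to `1`, the
sum of the weights of all admissible paths from the `i`-th bottom point to the `j`-th top
point converges (unconditionally) to the value at `t` of the rational function `G j i`. -/
def TangleDiagram.HasWalkMatrix {n : ℕ} (D : TangleDiagram (pos n) (pos n))
    (G : Matrix (Fin n) (Fin n) (RatFunc ℚ)) : Prop :=
  ∀ᶠ t in 𝓝 (1 : ℂ), ∀ i j : Fin n,
    HasSum (fun γ : D.AdmissiblePath (D.bottom i) (D.top j) => D.pathWeight t γ)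
      (RatFunc.eval (algebraMap ℚ ℂ) t (G j i))

/-! ### String links -/

/-- Every component is an interval that starts at a bottom point and ends at a top point. -/
def TangleDiagram.IsStringLink {n : ℕ} (D : TangleDiagram (pos n) (pos n)) : Prop :=
  ∀ P : Point D, D.IsPoint P → ∃ i j : Fin n,
    Relation.ReflTransGen D.Follows (D.bottom i) P ∧ Relation.ReflTransGen D.Follows P (D.top j)

/-- String links on `n` strands. -/
def StringLink (n : ℕ) : Type :=
  {T : Tangle (pos n) (pos n) // ∃ D : TangleDiagram (pos n) (pos n), D.toTangle = T ∧
    D.IsStringLink}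

/-- The diagrams of a string link. -/
def StringLink.IsDiagram {n : ℕ} (T : StringLink n) (D : TangleDiagram (pos n) (pos n)) : Prop :=
  D.toTangle = T.1

open Classical in
/-- The random walk invariant: the common random walk matrix of all diagrams of `T`. (The
default value `0` is only there to have a total definition.) -/
noncomputable def StringLink.walkMatrix {n : ℕ} (T : StringLink n) :
    Matrix (Fin n) (Fin n) (RatFunc ℚ) :=
  if h : ∃ G : Matrix (Fin n) (Fin n) (RatFunc ℚ), ∀ D, T.IsDiagram D → D.HasWalkMatrix G then
    h.choose else 0

/-! ### Braids and the Burau representation -/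

/-- The relators of the standard presentation of the braid group on `N` strands; the generator
`σ i` braids the strands at positions `i` and `i + 1`, counted from `0`. -/
inductive IsBraidRelator (N : ℕ) : FreeGroup (Fin (N - 1)) → Prop
  | braid (i j : Fin (N - 1)) (h : (i : ℕ) + 1 = j) : IsBraidRelator N
      (.of i * .of j * .of i * (.of j * .of i * .of j)⁻¹)
  | comm (i j : Fin (N - 1)) (h : (i : ℕ) + 2 ≤ j) : IsBraidRelator N
      (.of i * .of j * (.of j * .of i)⁻¹)

/-- The braid group on `N` strands. -/
abbrev BraidGroup (N : ℕ) : Type := PresentedGroup {r | IsBraidRelator N r}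

/-- The braid given by a word in the generators (`true`) and their inverses (`false`). -/
def braidOfWord (N : ℕ) (w : List (Fin (N - 1) × Bool)) : BraidGroup N :=
  PresentedGroup.mk _ (FreeGroup.mk w)

section Burau

variable {R : Type*} [CommRing R]

/-- The Burau matrix of a generator: the identity matrix with the block `[1 - t, 1; t, 0]` at
positions `i, i + 1`. -/
def burauMatrix (t : R) (N : ℕ) (i : Fin (N - 1)) : Matrix (Fin N) (Fin N) R := fun r c =>
  if (r : ℕ) = i ∧ (c : ℕ) = i then 1 - t
  else if (r : ℕ) = i ∧ (c : ℕ) = i + 1 then 1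
  else if (r : ℕ) = i + 1 ∧ (c : ℕ) = i then t
  else if (r : ℕ) = i + 1 ∧ (c : ℕ) = i + 1 then 0
  else if r = c then 1 else 0

/-- Its inverse, with the block `[0, t'; 1, 1 - t']` where `t' = t⁻¹`. -/
def burauMatrixInv (t' : R) (N : ℕ) (i : Fin (N - 1)) : Matrix (Fin N) (Fin N) R := fun r c =>
  if (r : ℕ) = i ∧ (c : ℕ) = i then 0
  else if (r : ℕ) = i ∧ (c : ℕ) = i + 1 then t'
  else if (r : ℕ) = i + 1 ∧ (c : ℕ) = i then 1
  else if (r : ℕ) = i + 1 ∧ (c : ℕ) = i + 1 then 1 - t'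
  else if r = c then 1 else 0

theorem burauMatrix_mulVec (t : R) (N : ℕ) (i : Fin (N - 1)) (v : Fin N → R) (r : Fin N) :
    (burauMatrix t N i).mulVec v r =
      if (r : ℕ) = i then (1 - t) * v ⟨i, by omega⟩ + v ⟨i + 1, by omega⟩
      else if (r : ℕ) = i + 1 then t * v ⟨i, by omega⟩ else v r := by
  have key : burauMatrix t N i r =
      if (r : ℕ) = i then (1 - t) • Pi.single ⟨i, by omega⟩ 1 + Pi.single ⟨i + 1, by omega⟩ 1
      else if (r : ℕ) = i + 1 then t • Pi.single ⟨i, by omega⟩ 1 else Pi.single r 1 := by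
    funext c
    simp only [burauMatrix]
    split_ifs <;> simp_all [Pi.single_apply, Fin.ext_iff]
  simp only [Matrix.mulVec, key]
  split_ifs <;> simp only [add_dotProduct, smul_dotProduct, single_dotProduct, one_mul, smul_eq_mul]

theorem burauMatrixInv_mulVec (t' : R) (N : ℕ) (i : Fin (N - 1)) (v : Fin N → R) (r : Fin N) :
    (burauMatrixInv t' N i).mulVec v r =
      if (r : ℕ) = i then t' * v ⟨i + 1, by omega⟩
      else if (r : ℕ) = i + 1 then v ⟨i, by omega⟩ + (1 - t') * v ⟨i + 1, by omega⟩ else v r := by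
  have key : burauMatrixInv t' N i r =
      if (r : ℕ) = i then t' • Pi.single ⟨i + 1, by omega⟩ 1
      else if (r : ℕ) = i + 1 then
        Pi.single ⟨i, by omega⟩ 1 + (1 - t') • Pi.single ⟨i + 1, by omega⟩ 1
      else Pi.single r 1 := by
    funext c
    simp only [burauMatrixInv]
    split_ifs <;> simp_all [Pi.single_apply, Fin.ext_iff]
  simp only [Matrix.mulVec, key]
  split_ifs <;> simp only [add_dotProduct, smul_dotProduct, single_dotProduct, one_mul, smul_eq_mul]

/-- The Burau matrix of a generator as an invertible matrix. -/
def burauUnit (t : Rˣ) (N : ℕ) (i : Fin (N - 1)) : GL (Fin N) R where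
  val := burauMatrix (t : R) N i
  inv := burauMatrixInv (↑t⁻¹ : R) N i
  val_inv := by
    apply Matrix.mulVec_injective
    funext v r
    simp only [← Matrix.mulVec_mulVec, burauMatrix_mulVec, burauMatrixInv_mulVec, Matrix.one_mulVec]
    have ht : (t : R) * (↑t⁻¹ : R) = 1 := t.mul_inv
    by_cases h1 : (r : ℕ) = i
    · have hr : r = ⟨i, by omega⟩ := Fin.ext h1
      rw [hr]
      simp
      linear_combination (-v ⟨i + 1, by omega⟩) * ht
    · by_cases h2 : (r : ℕ) = i + 1
      · have hr : r = ⟨i + 1, by omega⟩ := Fin.ext h2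
        rw [hr]
        simp
      · simp [h1, h2]
  inv_val := by
    apply Matrix.mulVec_injective
    funext v r
    simp only [← Matrix.mulVec_mulVec, burauMatrix_mulVec, burauMatrixInv_mulVec, Matrix.one_mulVec]
    have ht : (t : R) * (↑t⁻¹ : R) = 1 := t.mul_inv
    by_cases h1 : (r : ℕ) = i
    · have hr : r = ⟨i, by omega⟩ := Fin.ext h1
      rw [hr]
      simp
    · by_cases h2 : (r : ℕ) = i + 1
      · have hr : r = ⟨i + 1, by omega⟩ := Fin.ext h2
        rw [hr]
        simp
        linear_combination (-v ⟨i, by omega⟩) * ht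
      · simp [h1, h2]

theorem burauUnit_braid (t : Rˣ) (N : ℕ) (i j : Fin (N - 1)) (h : (i : ℕ) + 1 = j) :
    burauUnit t N i * burauUnit t N j * burauUnit t N i =
      burauUnit t N j * burauUnit t N i * burauUnit t N j := by
  apply Units.ext
  apply Matrix.mulVec_injective
  funext v r
  simp only [Units.val_mul, burauUnit, ← Matrix.mulVec_mulVec, burauMatrix_mulVec, ← h]
  split_ifs <;> first | omega | ring

theorem burauUnit_comm (t : Rˣ) (N : ℕ) (i j : Fin (N - 1)) (h : (i : ℕ) + 2 ≤ j) :
    burauUnit t N i * burauUnit t N j = burauUnit t N j * burauUnit t N i := by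
  apply Units.ext
  apply Matrix.mulVec_injective
  funext v r
  simp only [Units.val_mul, burauUnit, ← Matrix.mulVec_mulVec, burauMatrix_mulVec]
  split_ifs <;> first | omega | rfl

theorem burau_relators (t : Rˣ) (N : ℕ) :
    ∀ r ∈ {r | IsBraidRelator N r}, FreeGroup.lift (burauUnit t N) r = 1 := by
  rintro r (⟨i, j, h⟩ | ⟨i, j, h⟩)
  · simp only [map_mul, map_inv, FreeGroup.lift_apply_of]
    rw [burauUnit_braid t N i j h, mul_inv_cancel]
  · simp only [map_mul, map_inv, FreeGroup.lift_apply_of]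
    rw [burauUnit_comm t N i j h, mul_inv_cancel]

end Burau

/-- The invertible element `t` of `ℤ[t, t⁻¹]`. -/
noncomputable def laurentT : ℤ[T;T⁻¹]ˣ where
  val := LaurentPolynomial.T 1
  inv := LaurentPolynomial.T (-1)
  val_inv := by rw [← LaurentPolynomial.T_add]; simp
  inv_val := by rw [← LaurentPolynomial.T_add]; simp

/-- The unreduced Burau representation of the braid group over `ℤ[t, t⁻¹]`. -/
noncomputable def burau (N : ℕ) : BraidGroup N →* GL (Fin N) ℤ[T;T⁻¹] :=
  PresentedGroup.toGroup (burau_relators laurentT N)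

/-- The embedding of `ℤ[t, t⁻¹]` into `ℚ(t)`. -/
noncomputable def laurentToRatFunc : ℤ[T;T⁻¹] →+* RatFunc ℚ :=
  LaurentPolynomial.eval₂ (Int.castRingHom (RatFunc ℚ)) (Units.mk0 RatFunc.X RatFunc.X_ne_zero)

/-- The Burau matrix of a braid, with its entries in `ℚ(t)`. -/
noncomputable def burauRat (N : ℕ) (b : BraidGroup N) : Matrix (Fin N) (Fin N) (RatFunc ℚ) :=
  (burau N b).1.map laurentToRatFunc

/-! ### Partial closures of braids -/

/-- `m` nested minima to the right of `n` upward strands. -/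
def closureCups (n : ℕ) : ℕ → List Slice
  | 0 => []
  | m + 1 => closureCups n m ++ [⟨pos (n + m), .cup true, List.replicate m false⟩]

/-- `m` nested maxima to the right of `n` upward strands. -/
def closureCaps (n : ℕ) : ℕ → List Slice
  | 0 => []
  | m + 1 => ⟨pos (n + m), .cap true, List.replicate m false⟩ :: closureCaps n m

/-- A letter of a braid word on `N` upward strands, with `m` downward strands to its right. In `σ i`
the strand from bottom left to top right is over, in its inverse it is under. -/
def braidSlice (N m : ℕ) (g : Fin (N - 1) × Bool) : Slice :=
  ⟨pos g.1, .cross true true g.2, pos (N - 2 - g.1) ++ List.replicate m false⟩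

theorem Composable.append {ε δ ζ : List Bool} {v w : List Slice} (hv : Composable ε v δ)
    (hw : Composable δ w ζ) : Composable ε (v ++ w) ζ := by
  induction v generalizing ε with
  | nil => cases hv; exact hw
  | cons s v ih => exact ⟨hv.1, ih hv.2⟩

theorem composable_cups (n m : ℕ) :
    Composable (pos n) (closureCups n m) (pos (n + m) ++ List.replicate m false) := by
  induction m with
  | zero => simp [closureCups, Composable]
  | succ m ih =>
    refine ih.append ⟨?_, ?_⟩
    · simp [Slice.dom, Gen.dom]
    · simp [Composable, Slice.cod, Gen.cod, List.replicate_succ', ← Nat.add_assoc, pos]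
      simp [← List.replicate_succ', List.replicate_succ]

theorem composable_caps (n m : ℕ) :
    Composable (pos (n + m) ++ List.replicate m false) (closureCaps n m) (pos n) := by
  induction m with
  | zero => simp [closureCaps, Composable]
  | succ m ih =>
    refine ⟨?_, ?_⟩
    · simp [Slice.dom, Gen.dom, List.replicate_succ', ← Nat.add_assoc, pos]
      simp [← List.replicate_succ', List.replicate_succ]
    · simpa [Slice.cod, Gen.cod] using ih

theorem composable_braid (N m : ℕ) (w : List (Fin (N - 1) × Bool)) :
    Composable (pos N ++ List.replicate m false) (w.map (braidSlice N m))
      (pos N ++ List.replicate m false) := by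
  induction w with
  | nil => rfl
  | cons g w ih =>
    have h : pos N = pos g.1 ++ [true, true] ++ pos (N - 2 - g.1) := by
      have := g.1.2
      have e : [true, true] = List.replicate 2 true := rfl
      rw [e, pos, pos, pos, ← List.replicate_add, ← List.replicate_add]
      congr 1
      omega
    have h1 : (braidSlice N m g).dom = pos N ++ List.replicate m false := by
      rw [h]; simp [Slice.dom, braidSlice, Gen.dom]
    have h2 : (braidSlice N m g).cod = pos N ++ List.replicate m false := by
      rw [h]; simp [Slice.cod, braidSlice, Gen.cod]
    refine ⟨h1, ?_⟩
    rw [h2]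
    exact ih

/-- The diagram obtained from the braid diagram of a word on `n + m` strands by closing the last `m`
strands on the right. The product `b * b'` of braids is `b` stacked on top of `b'`, so the last
letter of the word is the lowest crossing. -/
def closureDiagram (n m : ℕ) (w : List (Fin (n + m - 1) × Bool)) :
    TangleDiagram (pos n) (pos n) where
  word := closureCups n m ++ w.reverse.map (braidSlice (n + m) m) ++ closureCaps n m
  composable :=
    ((composable_cups n m).append (composable_braid (n + m) m w.reverse)).append
      (composable_caps n m)

/-- The string link `T` is the partial closure of the braid `b` (along its last `m` strands). -/
def StringLink.IsClosureOf {n : ℕ} (T : StringLink n) (m : ℕ) (b : BraidGroup (n + m)) : Prop :=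
  ∃ w : List (Fin (n + m - 1) × Bool), braidOfWord (n + m) w = b ∧
    T.IsDiagram (closureDiagram n m w)

end RandomWalk

namespace RandomWalk

open Filter Topology
open scoped LaurentPolynomial ENNReal

/-! ### Colourings of slices and words -/

/-! A colouring gives every point of a diagram a complex label, in such a way that the label at a
point is the weighted mean of the labels at the ends of the steps leaving it. It is a harmonic
function for the random walk, whose boundary is the top row. When the sums over the paths to the
`j`-th top point converge, first-step analysis shows that, as functions of the starting point, they
form a colouring whose top row is the `j`-th unit row. So the walk matrix can be read off the pairs
of a bottom and a top row that extend to colourings.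

Invariance. For `t ≠ 0` no local move changes these pairs (`LocalMove.colorEquiv`,
`TangleDiagram.invariant_of_toTangle_eq`).

Convergence. At `t = 1` drops have weight `0`, and colourings are constant along the strands. The
absence of closed components is replaced by `Rigid`, a condition on colourings at `t = 1`, which
therefore also survives the moves. It yields a bounded height `d` that decreases along the strands
(`exists_height`). Near `t = 1` the weighted sum of `8 ^ d` over the steps from a point is at most
half of its value at the point (`tsum_weight_mul_le`). A geometric series then bounds the path sums,
and the same contraction makes harmonic functions unique (`hasSum_weight`). Together this is
`eventually_hasSum`.

Computation. By invariance the rows may be computed in the closed braid. Labels pass from the top to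
the bottom of the braid through right multiplication by its Burau matrix (`colored_braid`). With top
row `y`, bottom row `x` and labels `c` on the closing arcs this says `x = y X + c Z` and `c = y Y +
c Q`, and eliminating `c` leaves the Schur complement. A kernel vector of `1 - Q` at `t = 1` would
violate rigidity (`det_ne_zero_of_rigid`). Hence `det (1 - Q)` does not vanish at `1`, so neither
near `1` nor as an element of `ℚ(t)`. -/

/-- The label at the top left of a crossing whose labels at the bottom are `p`, `q`. -/
noncomputable def crossLeft (t : ℂ) (a _b o : Bool) (p q : ℂ) : ℂ :=
  if o then q else (if a then t else t⁻¹) * q + (1 - if a then t else t⁻¹) * p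

/-- The label at the top right of a crossing whose labels at the bottom are `p`, `q`. -/
noncomputable def crossRight (t : ℂ) (_a b o : Bool) (p q : ℂ) : ℂ :=
  if o then (if b then t⁻¹ else t) * p + (1 - if b then t⁻¹ else t) * q else p

/-- The labels at the bottom and at the top of an elementary piece fit together. -/
def Gen.Colors (t : ℂ) : Gen → List ℂ → List ℂ → Prop
  | .cup _, x, y => x = [] ∧ ∃ u, y = [u, u]
  | .cap _, x, y => y = [] ∧ ∃ u, x = [u, u]
  | .cross a b o, x, y => ∃ p q, x = [p, q] ∧ y = [crossLeft t a b o p q, crossRight t a b o p q]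

def Slice.Colors (t : ℂ) (s : Slice) (x y : List ℂ) : Prop :=
  ∃ l r g g', l.length = s.left.length ∧ r.length = s.right.length ∧ s.gen.Colors t g g' ∧
    x = l ++ (g ++ r) ∧ y = l ++ (g' ++ r)

/-- `tr` is the list of the rows of labels, from the bottom `x` on and without the top row `y`, of
a colouring of the word. -/
def Colored (t : ℂ) : List Slice → List ℂ → List ℂ → List (List ℂ) → Prop
  | [], x, y, tr => x = y ∧ tr = []
  | s :: w, x, y, tr => ∃ z tr', s.Colors t x z ∧ Colored t w z y tr' ∧ tr = x :: tr'

theorem Gen.Colors.length_dom {t : ℂ} {g : Gen} {x y : List ℂ} (h : g.Colors t x y) :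
    x.length = g.dom.length := by
  cases g <;> simp only [Gen.Colors] at h
  · simp [h.1, Gen.dom]
  · obtain ⟨_, u, rfl⟩ := h; simp [Gen.dom]
  · obtain ⟨p, q, rfl, _⟩ := h; simp [Gen.dom]

theorem Gen.Colors.length_cod {t : ℂ} {g : Gen} {x y : List ℂ} (h : g.Colors t x y) :
    y.length = g.cod.length := by
  cases g <;> simp only [Gen.Colors] at h
  · obtain ⟨_, u, rfl⟩ := h; simp [Gen.cod]
  · simp [h.1, Gen.cod]
  · obtain ⟨p, q, _, rfl⟩ := h
    simp [Gen.cod]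

theorem Slice.Colors.length_dom {t : ℂ} {s : Slice} {x y : List ℂ} (h : s.Colors t x y) :
    x.length = s.dom.length := by
  obtain ⟨l, r, g, g', hl, hr, hg, rfl, rfl⟩ := h
  simp [Slice.dom, hl, hr, hg.length_dom]

theorem Slice.Colors.length_cod {t : ℂ} {s : Slice} {x y : List ℂ} (h : s.Colors t x y) :
    y.length = s.cod.length := by
  obtain ⟨l, r, g, g', hl, hr, hg, rfl, rfl⟩ := h
  simp [Slice.cod, hl, hr, hg.length_cod]

theorem exists_append_of_length_eq {α : Type*} {l : List α} {m n : ℕ} (h : l.length = m + n) :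
    ∃ a b, l = a ++ b ∧ a.length = m ∧ b.length = n :=
  ⟨l.take m, l.drop m, by simp, by simp; omega, by simp; omega⟩

theorem Slice.colors_whisker {t : ℂ} {s : Slice} {l r : List Bool} {xl x xr y : List ℂ}
    (hl : xl.length = l.length) (hr : xr.length = r.length) :
    (s.whisker l r).Colors t (xl ++ (x ++ xr)) y ↔
      ∃ z, y = xl ++ (z ++ xr) ∧ s.Colors t x z := by
  constructor
  · rintro ⟨l', r', g, g', hl', hr', hg, hx, rfl⟩
    simp only [Slice.whisker, List.length_append] at hl' hr' hg
    obtain ⟨l₁, l₂, rfl, hl₁, hl₂⟩ := exists_append_of_length_eq hl'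
    obtain ⟨r₁, r₂, rfl, hr₁, hr₂⟩ := exists_append_of_length_eq hr'
    rw [List.append_assoc] at hx
    obtain ⟨rfl, hx⟩ := List.append_inj hx (by omega)
    obtain ⟨rfl, rfl⟩ := List.append_inj' (s₁ := x) (t₁ := xr)
      (s₂ := l₂ ++ (g ++ r₁)) (t₂ := r₂) (by simpa using hx) (by omega)
    exact ⟨l₂ ++ (g' ++ r₁), by simp, l₂, r₁, g, g', hl₂, hr₁, hg, rfl, rfl⟩
  · rintro ⟨z, rfl, l', r', g, g', hl', hr', hg, rfl, rfl⟩
    exact ⟨xl ++ l', r' ++ xr, g, g', by simp [Slice.whisker, *], by simp [Slice.whisker, *], hg,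
      by simp, by simp⟩

theorem colored_map_whisker {t : ℂ} {w : List Slice} {l r : List Bool} {xl xr : List ℂ}
    (hl : xl.length = l.length) (hr : xr.length = r.length) {x y : List ℂ} {tr : List (List ℂ)} :
    Colored t (w.map (Slice.whisker l r)) (xl ++ (x ++ xr)) y tr ↔
      ∃ z tr', y = xl ++ (z ++ xr) ∧ tr = tr'.map (fun u => xl ++ (u ++ xr)) ∧
        Colored t w x z tr' := by
  induction w generalizing x tr with
  | nil =>
    constructor
    · rintro ⟨rfl, rfl⟩; exact ⟨x, [], rfl, rfl, rfl, rfl⟩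
    · rintro ⟨z, tr', rfl, rfl, rfl, rfl⟩; exact ⟨rfl, rfl⟩
  | cons s w ih =>
    simp only [List.map_cons, Colored, Slice.colors_whisker hl hr]
    constructor
    · rintro ⟨_, tr1, ⟨z, rfl, hz⟩, h, rfl⟩
      obtain ⟨z', tr', rfl, rfl, h'⟩ := ih.1 h
      exact ⟨z', x :: tr', rfl, rfl, z, tr', hz, h', rfl⟩
    · rintro ⟨z, _, rfl, rfl, z', tr', hz, h, rfl⟩
      exact ⟨_, _, ⟨z', rfl, hz⟩, ih.2 ⟨z, tr', rfl, rfl, h⟩, rfl⟩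

theorem colored_append {t : ℂ} {v w : List Slice} {x y : List ℂ} {tr : List (List ℂ)} :
    Colored t (v ++ w) x y tr ↔
      ∃ z tr₁ tr₂, Colored t v x z tr₁ ∧ Colored t w z y tr₂ ∧ tr = tr₁ ++ tr₂ := by
  induction v generalizing x tr with
  | nil =>
    constructor
    · intro h; exact ⟨x, [], tr, ⟨rfl, rfl⟩, h, rfl⟩
    · rintro ⟨z, _, tr₂, ⟨rfl, rfl⟩, h, rfl⟩; exact h
  | cons s v ih =>
    constructor
    · rintro ⟨z, tr', hs, h, rfl⟩
      obtain ⟨z', tr₁, tr₂, h1, h2, rfl⟩ := ih.1 h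
      exact ⟨z', x :: tr₁, tr₂, ⟨z, tr₁, hs, h1, rfl⟩, h2, rfl⟩
    · rintro ⟨z', _, tr₂, ⟨z, tr₁, hs, h1, rfl⟩, h2, rfl⟩
      exact ⟨z, tr₁ ++ tr₂, hs, ih.2 ⟨z', tr₁, tr₂, h1, h2, rfl⟩, rfl⟩

theorem composable_append {ε δ : List Bool} {v w : List Slice} (h : Composable ε (v ++ w) δ) :
    ∃ ζ, Composable ε v ζ ∧ Composable ζ w δ := by
  induction v generalizing ε with
  | nil => exact ⟨ε, rfl, h⟩
  | cons s v ih =>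
    obtain ⟨ζ, h1, h2⟩ := ih h.2
    exact ⟨ζ, ⟨h.1, h1⟩, h2⟩

theorem Colored.length_eq {t : ℂ} {w : List Slice} {x y : List ℂ} {tr : List (List ℂ)}
    {ε δ : List Bool} (h : Colored t w x y tr) (hw : Composable ε w δ)
    (hx : x.length = ε.length) : y.length = δ.length := by
  induction w generalizing ε x tr with
  | nil => cases h.1; cases hw; exact hx
  | cons s w ih =>
    obtain ⟨z, tr', hs, h, rfl⟩ := h
    exact ih h hw.2 hs.length_cod

/-- All labels of the row are zero. -/
def IsZeroRow (x : List ℂ) : Prop := ∀ u ∈ x, u = 0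

theorem Colored.isZeroRow_bottom {t : ℂ} {w : List Slice} {x y : List ℂ} {tr : List (List ℂ)}
    (h : Colored t w x y tr) (hy : IsZeroRow y) (htr : ∀ z ∈ tr, IsZeroRow z) : IsZeroRow x := by
  cases w with
  | nil => cases h.1; exact hy
  | cons s w =>
    obtain ⟨z, tr', hs, h, rfl⟩ := h
    exact htr x (by simp)

/-! ### Invariance under moves -/

theorem slice_colors_gen {t : ℂ} {g : Gen} {x y : List ℂ} :
    Slice.Colors t ⟨[], g, []⟩ x y ↔ g.Colors t x y := by
  constructor
  · rintro ⟨l, r, g0, g1, hl, hr, hg, rfl, rfl⟩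
    simp only [List.length_nil, List.length_eq_zero_iff] at hl hr
    subst hl hr
    simpa using hg
  · intro h
    exact ⟨[], [], x, y, rfl, rfl, h, by simp, by simp⟩

theorem slice_colors_left {t : ℂ} {g : Gen} {a : Bool} {x y : List ℂ} :
    Slice.Colors t ⟨[a], g, []⟩ x y ↔ ∃ u v w, x = u :: v ∧ y = u :: w ∧ g.Colors t v w := by
  constructor
  · rintro ⟨l, r, g0, g1, hl, hr, hg, rfl, rfl⟩
    simp only [List.length_nil, List.length_cons, zero_add, List.length_eq_zero_iff,
      List.length_eq_one_iff] at hl hr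
    obtain ⟨u, rfl⟩ := hl
    subst hr
    exact ⟨u, g0, g1, by simp, by simp, hg⟩
  · rintro ⟨u, v, w, rfl, rfl, h⟩
    exact ⟨[u], [], v, w, rfl, rfl, h, by simp, by simp⟩

theorem slice_colors_right {t : ℂ} {g : Gen} {a : Bool} {x y : List ℂ} :
    Slice.Colors t ⟨[], g, [a]⟩ x y ↔
      ∃ u v w, x = v ++ [u] ∧ y = w ++ [u] ∧ g.Colors t v w := by
  constructor
  · rintro ⟨l, r, g0, g1, hl, hr, hg, rfl, rfl⟩
    simp only [List.length_nil, List.length_cons, zero_add, List.length_eq_zero_iff,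
      List.length_eq_one_iff] at hl hr
    obtain ⟨u, rfl⟩ := hr
    subst hl
    exact ⟨u, g0, g1, by simp, by simp, hg⟩
  · rintro ⟨u, v, w, rfl, rfl, h⟩
    exact ⟨[], [u], v, w, rfl, rfl, h, by simp, by simp⟩

theorem colored_pair {t : ℂ} {s s' : Slice} {x y : List ℂ} {tr : List (List ℂ)} :
    Colored t [s, s'] x y tr ↔ ∃ z, s.Colors t x z ∧ s'.Colors t z y ∧ tr = [x, z] := by
  simp [Colored]

theorem colored_exchange_left {t : ℂ} {g h : Gen} {mid : List Bool} {x y : List ℂ}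
    {tr : List (List ℂ)} :
    Colored t [⟨[], g, mid ++ h.dom⟩, ⟨g.cod ++ mid, h, []⟩] x y tr ↔
      ∃ g0 g1 m h0 h1, g.Colors t g0 g1 ∧ h.Colors t h0 h1 ∧ m.length = mid.length ∧
        x = g0 ++ (m ++ h0) ∧ y = g1 ++ (m ++ h1) ∧ tr = [x, g1 ++ (m ++ h0)] := by
  rw [colored_pair]
  constructor
  · rintro ⟨z, ⟨l, r, g0, g1, hl, hr, hg, rfl, rfl⟩, ⟨l', r', h0, h1, hl', hr', hh, hz, rfl⟩, rfl⟩
    simp only [List.length_nil, List.length_eq_zero_iff, List.length_append] at hl hr hr' hl'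
    subst hl hr'
    obtain ⟨l₁, m, rfl, hl₁, hm⟩ := exists_append_of_length_eq hl'
    rw [List.append_assoc, List.nil_append] at hz
    obtain ⟨rfl, rfl⟩ := List.append_inj hz (by rw [hg.length_cod, hl₁])
    exact ⟨_, _, m, h0, h1, hg, hh, hm, by simp, by simp, by simp⟩
  · rintro ⟨g0, g1, m, h0, h1, hg, hh, hm, rfl, rfl, rfl⟩
    exact ⟨_, ⟨[], m ++ h0, g0, g1, rfl, by simp [hm, hh.length_dom], hg, rfl, rfl⟩,
      ⟨g1 ++ m, [], h0, h1, by simp [hm, hg.length_cod], rfl, hh, by simp, by simp⟩, by simp⟩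

theorem colored_exchange_right {t : ℂ} {g h : Gen} {mid : List Bool} {x y : List ℂ}
    {tr : List (List ℂ)} :
    Colored t [⟨g.dom ++ mid, h, []⟩, ⟨[], g, mid ++ h.cod⟩] x y tr ↔
      ∃ g0 g1 m h0 h1, g.Colors t g0 g1 ∧ h.Colors t h0 h1 ∧ m.length = mid.length ∧
        x = g0 ++ (m ++ h0) ∧ y = g1 ++ (m ++ h1) ∧ tr = [x, g0 ++ (m ++ h1)] := by
  rw [colored_pair]
  constructor
  · rintro ⟨z, ⟨l', r', h0, h1, hl', hr', hh, rfl, rfl⟩, ⟨l, r, g0, g1, hl, hr, hg, hz, rfl⟩, rfl⟩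
    simp only [List.length_nil, List.length_eq_zero_iff, List.length_append] at hl hr hr' hl'
    subst hl hr'
    obtain ⟨l₁, m, rfl, hl₁, hm⟩ := exists_append_of_length_eq hl'
    rw [List.append_assoc, List.nil_append] at hz
    obtain ⟨rfl, rfl⟩ := List.append_inj hz (by rw [hg.length_dom, hl₁])
    exact ⟨_, _, m, h0, h1, hg, hh, hm, by simp, by simp, by simp⟩
  · rintro ⟨g0, g1, m, h0, h1, hg, hh, hm, rfl, rfl, rfl⟩
    exact ⟨g0 ++ (m ++ h1), ⟨g0 ++ m, [], h0, h1, by simp [hm, hg.length_dom], rfl, hh, by simp,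
      by simp⟩, ⟨[], m ++ h1, g0, g1, rfl, by simp [hm, hh.length_cod], hg, rfl, rfl⟩, by simp⟩

/-- Two words have the same colourings up to a change of the inner labels, and the inner labels of
a colouring vanish when the outer ones do. -/
structure ColorEquiv (t : ℂ) (k : ℕ) (A B : List Slice) : Prop where
  forward : ∀ x y tr, x.length = k → Colored t A x y tr → ∃ tr', Colored t B x y tr'
  backward : ∀ x y tr, x.length = k → Colored t B x y tr → ∃ tr', Colored t A x y tr'
  zero_left : ∀ x y tr, x.length = k → Colored t A x y tr → IsZeroRow x → IsZeroRow y →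
    ∀ z ∈ tr, IsZeroRow z
  zero_right : ∀ x y tr, x.length = k → Colored t B x y tr → IsZeroRow x → IsZeroRow y →
    ∀ z ∈ tr, IsZeroRow z

theorem ColorEquiv.symm {t : ℂ} {k : ℕ} {A B : List Slice} (h : ColorEquiv t k A B) :
    ColorEquiv t k B A :=
  ⟨h.backward, h.forward, h.zero_right, h.zero_left⟩

theorem ColorEquiv.whisker {t : ℂ} {k : ℕ} {A B : List Slice} (h : ColorEquiv t k A B)
    (l r : List Bool) : ColorEquiv t (l.length + (k + r.length)) (A.map (Slice.whisker l r))
      (B.map (Slice.whisker l r)) := by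
  have split : ∀ x : List ℂ, x.length = l.length + (k + r.length) → ∃ xl x' xr,
      x = xl ++ (x' ++ xr) ∧ xl.length = l.length ∧ x'.length = k ∧ xr.length = r.length :=
    fun x hx => ⟨x.take l.length, (x.drop l.length).take k, (x.drop l.length).drop k,
      by simp [List.take_append_drop], by simp; omega, by simp; omega, by simp; omega⟩
  have zero : ∀ xl x xr : List ℂ, IsZeroRow (xl ++ (x ++ xr)) ↔
      IsZeroRow xl ∧ IsZeroRow x ∧ IsZeroRow xr := by
    intro xl x xr; simp only [IsZeroRow, List.mem_append]; grind
  refine ⟨?_, ?_, ?_, ?_⟩ <;> intro x y tr hx hc <;>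
    obtain ⟨xl, x, xr, rfl, h1, h2, h3⟩ := split x hx <;>
    obtain ⟨z, tr', rfl, rfl, hc'⟩ := (colored_map_whisker h1 h3).1 hc
  · obtain ⟨tr'', h''⟩ := h.forward _ _ _ h2 hc'
    exact ⟨_, (colored_map_whisker h1 h3).2 ⟨_, _, rfl, rfl, h''⟩⟩
  · obtain ⟨tr'', h''⟩ := h.backward _ _ _ h2 hc'
    exact ⟨_, (colored_map_whisker h1 h3).2 ⟨_, _, rfl, rfl, h''⟩⟩
  · intro z1 z2 u hu
    obtain ⟨v, hv, rfl⟩ := List.mem_map.1 hu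
    rw [zero] at z1 z2 ⊢
    exact ⟨z1.1, h.zero_left _ _ _ h2 hc' z1.2.1 z2.2.1 v hv, z1.2.2⟩
  · intro z1 z2 u hu
    obtain ⟨v, hv, rfl⟩ := List.mem_map.1 hu
    rw [zero] at z1 z2 ⊢
    exact ⟨z1.1, h.zero_right _ _ _ h2 hc' z1.2.1 z2.2.1 v hv, z1.2.2⟩

/-- Serves to read the width of the rows at which a move takes place off the first slice of its
left-hand side; the right-hand side may be empty. -/
theorem LocalMove.ne_nil {A B : List Slice} (h : LocalMove A B) : ∃ s A', A = s :: A' := by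
  cases h <;> exact ⟨_, _, rfl⟩

theorem isZeroRow_append {x y : List ℂ} : IsZeroRow (x ++ y) ↔ IsZeroRow x ∧ IsZeroRow y := by
  simp only [IsZeroRow, List.mem_append]; grind

theorem isZeroRow_cons {u : ℂ} {x : List ℂ} : IsZeroRow (u :: x) ↔ u = 0 ∧ IsZeroRow x :=
  List.forall_mem_cons

theorem isZeroRow_nil : IsZeroRow [] := by simp [IsZeroRow]

theorem colorEquiv_exchange (t : ℂ) (k : ℕ) (g h : Gen) (mid : List Bool) :
    ColorEquiv t k [⟨[], g, mid ++ h.dom⟩, ⟨g.cod ++ mid, h, []⟩]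
        [⟨g.dom ++ mid, h, []⟩, ⟨[], g, mid ++ h.cod⟩] := by
  refine ⟨?_, ?_, ?_, ?_⟩ <;> intro x y tr _ hc <;>
    simp only [colored_exchange_left, colored_exchange_right] at hc ⊢ <;>
    obtain ⟨g0, g1, m, h0, h1, hg, hh, hm, rfl, rfl, rfl⟩ := hc
  · exact ⟨_, g0, g1, m, h0, h1, hg, hh, hm, rfl, rfl, rfl⟩
  · exact ⟨_, g0, g1, m, h0, h1, hg, hh, hm, rfl, rfl, rfl⟩
  · simp only [isZeroRow_append, List.mem_cons, List.not_mem_nil, or_false]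
    rintro z1 z2 z (rfl | rfl) <;> simp [isZeroRow_append, z1, z2]
  · simp only [isZeroRow_append, List.mem_cons, List.not_mem_nil, or_false]
    rintro z1 z2 z (rfl | rfl) <;> simp [isZeroRow_append, z1, z2]

/-! ### Identities between the labels at crossings, as needed for the moves -/

section Crossings

variable {t : ℂ} (a c o : Bool) (p q : ℂ)

theorem crossLeft_crossRight_cap (ht : t ≠ 0) : crossLeft t c (!a) (!o) q (crossRight t a c o p q) = p := by
  cases a <;> cases c <;> cases o <;> simp [crossLeft, crossRight] <;> field_simp <;> ring

theorem crossRight_crossRight_cap :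
    crossRight t c (!a) (!o) q (crossRight t a c o p q) = crossLeft t a c o p q := by
  cases a <;> cases c <;> cases o <;> simp [crossLeft, crossRight]

theorem crossRight_crossLeft_cap (ht : t ≠ 0) : crossRight t a c o (crossLeft t c (!a) (!o) p q) p = q := by
  cases a <;> cases c <;> cases o <;> simp [crossLeft, crossRight] <;> field_simp <;> ring

theorem crossLeft_crossLeft_cap :
    crossLeft t a c o (crossLeft t c (!a) (!o) p q) p = crossRight t c (!a) (!o) p q := by
  cases a <;> cases c <;> cases o <;> simp [crossLeft, crossRight]

theorem crossLeft_crossLeft_cup :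
    crossLeft t (!a) c (!o) (crossLeft t c a o p q) p = crossRight t c a o p q := by
  cases a <;> cases c <;> cases o <;> simp [crossLeft, crossRight]

theorem crossRight_crossLeft_cup (ht : t ≠ 0) :
    crossRight t (!a) c (!o) (crossLeft t c a o p q) p = q := by
  cases a <;> cases c <;> cases o <;> simp [crossLeft, crossRight] <;> field_simp <;> ring

theorem crossLeft_crossRight_cup (ht : t ≠ 0) :
    crossLeft t c a o q (crossRight t (!a) c (!o) p q) = p := by
  cases a <;> cases c <;> cases o <;> simp [crossLeft, crossRight] <;> field_simp <;> ring

theorem crossRight_crossRight_cup :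
    crossRight t c a o q (crossRight t (!a) c (!o) p q) = crossLeft t (!a) c (!o) p q := by
  cases a <;> cases c <;> cases o <;> simp [crossLeft, crossRight]

theorem crossLeft_cross (ht : t ≠ 0) :
    crossLeft t c a (!o) (crossLeft t a c o p q) (crossRight t a c o p q) = p := by
  cases a <;> cases c <;> cases o <;> simp [crossLeft, crossRight] <;> field_simp <;> ring

theorem crossRight_cross (ht : t ≠ 0) :
    crossRight t c a (!o) (crossLeft t a c o p q) (crossRight t a c o p q) = q := by
  cases a <;> cases c <;> cases o <;> simp [crossLeft, crossRight] <;> field_simp <;> ring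

/-- The two top labels differ by `p - q` times `t` or `t⁻¹`. A maximum closing a kink therefore
already forces equal labels below the crossing. -/
theorem eq_of_crossRight_eq_crossLeft (ht : t ≠ 0) {a o : Bool} {p q : ℂ}
    (h : crossRight t a (!a) o p q = crossLeft t a (!a) o p q) : p = q := by
  cases a <;> cases o <;> simp [crossLeft, crossRight] at h <;> field_simp at h <;>
    first
    | linear_combination h
    | linear_combination -h
    | exact mul_left_cancel₀ ht (by linear_combination h)

end Crossings

theorem crossLeft_self (t : ℂ) (a b o : Bool) (p : ℂ) : crossLeft t a b o p p = p := by
  cases o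
  · simp only [crossLeft, Bool.false_eq_true, if_false]; ring
  · simp [crossLeft]

theorem crossRight_self (t : ℂ) (a b o : Bool) (p : ℂ) : crossRight t a b o p p = p := by
  cases o
  · simp [crossRight]
  · simp only [crossRight, if_true]; ring

theorem cross_braid {t : ℂ} (ht : t ≠ 0) (a b c o₁ o₂ o₃ : Bool) (h : o₁ = o₂ ∨ o₂ = o₃)
    (p q r : ℂ) :
    crossLeft t b c o₃ (crossLeft t a b o₁ p q) (crossLeft t a c o₂ (crossRight t a b o₁ p q) r) =
      crossLeft t a c o₂ p (crossLeft t b c o₃ q r) ∧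
    crossRight t b c o₃ (crossLeft t a b o₁ p q) (crossLeft t a c o₂ (crossRight t a b o₁ p q) r) =
      crossLeft t a b o₁ (crossRight t a c o₂ p (crossLeft t b c o₃ q r))
        (crossRight t b c o₃ q r) ∧
    crossRight t a c o₂ (crossRight t a b o₁ p q) r =
      crossRight t a b o₁ (crossRight t a c o₂ p (crossLeft t b c o₃ q r))
        (crossRight t b c o₃ q r) := by
  -- The strand `b` falls in its crossing with `a` and rises in its crossing with `c`, so as an
  -- under-strand it contributes inverse factors. This matters only in the two patterns where `b`
  -- lies lowest.
  have hb : (if b then t else t⁻¹) * (if b then t⁻¹ else t) = 1 := by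
    cases b <;> simp [ht]
  unfold crossLeft crossRight
  generalize (if a then t else t⁻¹) = ua
  generalize (if b then t else t⁻¹) = ub at hb ⊢
  generalize (if b then t⁻¹ else t) = vb at hb ⊢
  generalize (if c then t⁻¹ else t) = vc
  cases o₁ <;> cases o₂ <;> cases o₃ <;> simp at h ⊢
  · ring
  · ring
  · ring
  · linear_combination (1 - ua) * (p - q) * hb
  · linear_combination -(1 - vc) * (r - q) * hb
  · ring

theorem LocalMove.colorEquiv {t : ℂ} (ht : t ≠ 0) {A B : List Slice} (h : LocalMove A B)
    {s : Slice} {A' : List Slice} (hA : A = s :: A') : ColorEquiv t s.dom.length A B := by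
  have zero : ∀ x y tr, x.length = s.dom.length →
      (Colored t A x y tr ∨ Colored t B x y tr) → IsZeroRow x → IsZeroRow y →
        ∀ z ∈ tr, IsZeroRow z := by
    intro x y tr hx hc h1 h2
    cases h with
    | exchange g h mid =>
      exact hc.elim (fun hc => (colorEquiv_exchange t _ g h mid).zero_left x y tr hx hc h1 h2)
        (fun hc => (colorEquiv_exchange t _ g h mid).zero_right x y tr hx hc h1 h2)
    -- A label created at a minimum reaches the top row or is joined to a bottom label by a maximum,
    -- so zero outer rows leave no inner label free.
    | _ =>
      clear hA hx
      simp only [slice_colors_left, slice_colors_gen, slice_colors_right, Gen.Colors, Colored,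
        List.cons_eq_cons, ↓existsAndEq, and_true, true_and, List.cons_append, List.nil_append]
        at hc
      grind [isZeroRow_cons, isZeroRow_nil, crossLeft_self, crossRight_self]
  -- The length of `x` has to be prescribed because an empty `B` is coloured by rows of every
  -- length.
  suffices h : ∀ x y, x.length = s.dom.length →
      ((∃ tr, Colored t A x y tr) ↔ ∃ tr, Colored t B x y tr) from
    ⟨fun x y tr hx hc => (h x y hx).1 ⟨tr, hc⟩, fun x y tr hx hc => (h x y hx).2 ⟨tr, hc⟩,
      fun x y tr hx hc => zero x y tr hx (.inl hc), fun x y tr hx hc => zero x y tr hx (.inr hc)⟩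
  intro x y hx
  clear zero
  cases h
  case exchange g h mid =>
    exact ⟨fun ⟨tr, hc⟩ => (colorEquiv_exchange t _ g h mid).forward x y tr rfl hc,
      fun ⟨tr, hc⟩ => (colorEquiv_exchange t _ g h mid).backward x y tr rfl hc⟩
  all_goals
    cases hA
    simp only [Slice.dom, Gen.dom, List.length_cons, List.length_append, List.length_nil,
      List.append_nil, List.nil_append, zero_add, Nat.reduceAdd] at hx
    simp only [slice_colors_left, slice_colors_gen, slice_colors_right, Gen.Colors, Colored,
      List.cons_eq_cons, ↓existsAndEq, and_true, true_and, List.cons_append, List.nil_append]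
  case zigzagRight.refl a =>
    obtain ⟨u, rfl⟩ := List.length_eq_one_iff.1 hx
    simp
  case zigzagLeft.refl a =>
    obtain ⟨u, rfl⟩ := List.length_eq_one_iff.1 hx
    simp
  case slideCap.refl a c o =>
    constructor
    · rintro ⟨p, q, rfl, rfl⟩
      exact ⟨q, crossRight t a c o p q, by rw [crossLeft_crossRight_cap _ _ _ _ _ ht],
        by rw [crossRight_crossRight_cap]⟩
    · rintro ⟨p, q, rfl, rfl⟩
      exact ⟨crossLeft t c (!a) (!o) p q, p, by rw [crossRight_crossLeft_cap _ _ _ _ _ ht],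
        by rw [crossLeft_crossLeft_cap]⟩
  case slideCup.refl a c o =>
    constructor
    · rintro ⟨u, p, rfl, rfl⟩
      exact ⟨crossLeft t c a o p u, p, rfl, by
        rw [crossLeft_crossLeft_cup, crossRight_crossLeft_cup _ _ _ _ _ ht]⟩
    · rintro ⟨u, q, rfl, rfl⟩
      exact ⟨crossRight t (!a) c (!o) u q, q, rfl, by
        rw [crossRight_crossRight_cup, crossLeft_crossRight_cup _ _ _ _ _ ht]⟩
  case reidemeister1Cap.refl a o =>
    constructor
    · rintro ⟨p, q, rfl, h, rfl⟩
      obtain rfl := eq_of_crossRight_eq_crossLeft ht h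
      exact ⟨⟨p, rfl⟩, rfl⟩
    · rintro ⟨⟨u, rfl⟩, rfl⟩
      exact ⟨u, u, rfl, by rw [crossLeft_self, crossRight_self], rfl⟩
  case reidemeister1Cup.refl a o =>
    simp only [crossLeft_self, crossRight_self]
  case reidemeister2.refl a c o =>
    obtain ⟨u, v, rfl⟩ := List.length_eq_two.1 hx
    simp [crossLeft_cross _ _ _ _ _ ht, crossRight_cross _ _ _ _ _ ht]
  case reidemeister3.refl a b c o₁ o₂ o₃ h =>
    constructor
    · rintro ⟨r, p, q, rfl, rfl⟩
      obtain ⟨h1, h2, h3⟩ := cross_braid ht a b c o₁ o₂ o₃ h p q r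
      exact ⟨p, q, r, rfl, by rw [h1, h2, h3]⟩
    · rintro ⟨p, q, r, rfl, rfl⟩
      obtain ⟨h1, h2, h3⟩ := cross_braid ht a b c o₁ o₂ o₃ h p q r
      exact ⟨r, p, q, rfl, by rw [h1, h2, h3]⟩

/-- A colouring at `t = 1` whose top row vanishes is zero. -/
def Rigid (ε : List Bool) (w : List Slice) : Prop :=
  ∀ x y tr, x.length = ε.length → Colored 1 w x y tr → IsZeroRow y → ∀ z ∈ tr, IsZeroRow z

/-! ### Transport of colourings and of rigidity along moves -/

theorem ColorEquiv.exists_colored {t : ℂ} {k : ℕ} {A B lower upper : List Slice}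
    {ε ζ : List Bool} (h : ColorEquiv t k A B) (hl : Composable ε lower ζ) (hk : ζ.length = k)
    {x y : List ℂ} {tr : List (List ℂ)} (hx : x.length = ε.length)
    (hc : Colored t (lower ++ (A ++ upper)) x y tr) :
    ∃ tr', Colored t (lower ++ (B ++ upper)) x y tr' := by
  simp only [colored_append] at hc ⊢
  obtain ⟨z, tr₁, _, h1, ⟨z', tr₂, tr₃, h2, h3, rfl⟩, rfl⟩ := hc
  obtain ⟨tr₂', h2'⟩ := h.forward z z' tr₂ ((h1.length_eq hl hx).trans hk) h2
  exact ⟨_, z, tr₁, _, h1, ⟨z', tr₂', tr₃, h2', h3, rfl⟩, rfl⟩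

/-- Exchange the colouring of `A` for one of `B` with the same outer rows. Rigidity kills all rows
outside the piece, hence both rows bounding it, and `zero_left` then kills the inner rows of the
original colouring of `A`. -/
theorem ColorEquiv.rigid {k : ℕ} {A B lower upper : List Slice}
    {ε ζ : List Bool} (h : ColorEquiv 1 k A B) (hl : Composable ε lower ζ) (hk : ζ.length = k)
    (hr : Rigid ε (lower ++ (B ++ upper))) : Rigid ε (lower ++ (A ++ upper)) := by
  intro x y tr hx hc hy
  simp only [colored_append] at hc
  obtain ⟨z, tr₁, _, h1, ⟨z', tr₂, tr₃, h2, h3, rfl⟩, rfl⟩ := hc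
  have hz := (h1.length_eq hl hx).trans hk
  obtain ⟨tr₂', h2'⟩ := h.forward z z' tr₂ hz h2
  have key := hr x y (tr₁ ++ (tr₂' ++ tr₃)) hx (by
    simp only [colored_append]
    exact ⟨z, tr₁, _, h1, ⟨z', tr₂', tr₃, h2', h3, rfl⟩, rfl⟩) hy
  have z3 : ∀ u ∈ tr₃, IsZeroRow u := fun u hu => key u (by simp [hu])
  have zz' := h3.isZeroRow_bottom hy z3
  have zz := h2'.isZeroRow_bottom zz' fun u hu => key u (by simp [hu])
  intro u hu
  simp only [List.mem_append] at hu
  rcases hu with hu | hu | hu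
  · exact key u (by simp [hu])
  · exact h.zero_left z z' tr₂ hz h2 zz zz' u hu
  · exact z3 u hu

theorem TangleDiagram.Move.colorEquiv {ε δ : List Bool} {D D' : TangleDiagram ε δ}
    (h : D.Move D') : ∃ (lower upper A B : List Slice) (ζ : List Bool),
      D.word = lower ++ (A ++ upper) ∧ D'.word = lower ++ (B ++ upper) ∧
      Composable ε lower ζ ∧ ∀ t ≠ 0, ColorEquiv t ζ.length A B := by
  obtain ⟨lower, upper, l, r, A, B, hAB, hD, hD'⟩ := h
  rw [List.append_assoc] at hD hD'
  obtain ⟨s, A', rfl⟩ := hAB.ne_nil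
  have hc := D.composable
  rw [hD] at hc
  obtain ⟨ζ, h1, h2⟩ := composable_append hc
  refine ⟨lower, upper, _, _, ζ, hD, hD', h1, fun t ht => ?_⟩
  have e : ζ.length = l.length + (s.dom.length + r.length) := by
    rw [← h2.1]; simp [Slice.dom, Slice.whisker]; omega
  rw [e]
  exact (hAB.colorEquiv ht rfl).whisker l r

theorem TangleDiagram.Move.invariant {ε δ : List Bool} {D D' : TangleDiagram ε δ}
    (h : D.Move D') : (Rigid ε D.word ↔ Rigid ε D'.word) ∧
      ∀ t ≠ 0, ∀ x y : List ℂ, x.length = ε.length →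
        ((∃ tr, Colored t D.word x y tr) ↔ ∃ tr, Colored t D'.word x y tr) := by
  obtain ⟨lower, upper, A, B, ζ, hD, hD', hl, hc⟩ := h.colorEquiv
  rw [hD, hD']
  refine ⟨⟨(hc 1 one_ne_zero).symm.rigid hl rfl, (hc 1 one_ne_zero).rigid hl rfl⟩, ?_⟩
  intro t ht x y hx
  exact ⟨fun ⟨tr, h⟩ => (hc t ht).exists_colored hl rfl hx h,
    fun ⟨tr, h⟩ => (hc t ht).symm.exists_colored hl rfl hx h⟩

theorem TangleDiagram.invariant_of_toTangle_eq {ε δ : List Bool} {D D' : TangleDiagram ε δ}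
    (h : D.toTangle = D'.toTangle) : (Rigid ε D.word ↔ Rigid ε D'.word) ∧
      ∀ t ≠ 0, ∀ x y : List ℂ, x.length = ε.length →
        ((∃ tr, Colored t D.word x y tr) ↔ ∃ tr, Colored t D'.word x y tr) := by
  have h' := Quot.eqvGen_exact h
  clear h
  induction h' with
  | rel _ _ h => exact TangleDiagram.Move.invariant h
  | refl => exact ⟨Iff.rfl, fun _ _ _ _ _ => Iff.rfl⟩
  | symm _ _ _ ih => exact ⟨ih.1.symm, fun t ht x y hx => (ih.2 t ht x y hx).symm⟩
  | trans _ _ _ _ _ ih1 ih2 =>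
    exact ⟨ih1.1.trans ih2.1, fun t ht x y hx => (ih1.2 t ht x y hx).trans (ih2.2 t ht x y hx)⟩

/-! ### Steps from a given point, and harmonic functions -/

/-- The steps from a point, given by their turns and their end points: there is none, or a single
one of weight `1`, or two of them in a crossing arrived at along the over-strand. -/
def Fan {V : Type*} (R : Turn → V → Prop) : Prop :=
  (∀ τ y, ¬ R τ y) ∨
  (∃ τ y, (τ = .free ∨ τ = .under) ∧ ∀ τ' y', R τ' y' ↔ τ' = τ ∧ y' = y) ∨
  (∃ b y z, ∀ τ' y', R τ' y' ↔ (τ' = .straight b ∧ y' = y) ∨ (τ' = .drop b ∧ y' = z))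

/-- The number `c` is the mean of the values of `h` at the end points of the steps. -/
def Mean {V : Type*} (t : ℂ) (R : Turn → V → Prop) (h : V → ℂ) (c : ℂ) : Prop :=
  (∀ y, R .free y → c = h y) ∧ (∀ y, R .under y → c = h y) ∧
    ∀ b y z, R (.straight b) y → R (.drop b) z →
      c = Turn.weight t (.straight b) * h y + Turn.weight t (.drop b) * h z

theorem Fan.or {V : Type*} {R S : Turn → V → Prop} (hR : Fan R) (hS : Fan S)
    (h : ∀ τ y τ' y', R τ y → ¬ S τ' y') : Fan (fun τ y => R τ y ∨ S τ y) := by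
  by_cases hex : ∃ τ y, R τ y
  · obtain ⟨τ, y, hy⟩ := hex
    have : (fun τ y => R τ y ∨ S τ y) = R := by
      funext τ' y'; simp [h τ y τ' y' hy]
    rwa [this]
  · push Not at hex
    have : (fun τ y => R τ y ∨ S τ y) = S := by
      funext τ' y'; simp [hex τ' y']
    rwa [this]

theorem fan_strand (x : End) (e : End × End) :
    Fan (fun τ y => τ = Turn.free ∧ (x, y) = e) := by
  obtain ⟨u, v⟩ := e
  by_cases h : x = u
  · exact .inr (.inl ⟨.free, v, .inl rfl, by simp [h]⟩)
  · exact .inl (by simp [h])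

theorem fan_crossing (x : End) (o u : End × End) (b : Bool) (h : o.1 ≠ u.1) :
    Fan (fun τ y => (τ = Turn.under ∧ (x, y) = u) ∨ (τ = .straight b ∧ (x, y) = o) ∨
      (τ = .drop b ∧ (x, y) = (o.1, u.2))) := by
  obtain ⟨o1, o2⟩ := o
  obtain ⟨u1, u2⟩ := u
  dsimp only at h
  by_cases h1 : x = u1
  · subst h1
    exact .inr (.inl ⟨.under, u2, .inr rfl, by simp [h.symm]⟩)
  · by_cases h2 : x = o1
    · subst h2
      exact .inr (.inr ⟨b, o2, u2, by simp [h1]⟩)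
    · exact .inl (by simp [h1, h2])

theorem Gen.fan (g : Gen) (x : End) : Fan (g.IsStep x) := by
  cases g with
  | cup b => exact fan_strand _ _
  | cap b => exact fan_strand _ _
  | cross a b o =>
    refine fan_crossing x _ _ _ ?_
    cases a <;> cases b <;> cases o <;> simp [orient]

/-- The end of a slice is the start of the strand segment meeting it. -/
def IsStart (lower upper : List Bool) : End → Prop
  | .bot p => lower[p]? = some true
  | .top p => upper[p]? = some false

theorem Gen.IsStep.isStart {g : Gen} {x y : End} {τ : Turn} (h : g.IsStep x τ y) :
    IsStart g.dom g.cod x := by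
  cases g with
  | cup b =>
    obtain ⟨_, h⟩ := h
    cases b <;> simp [orient] at h <;> simp [h, IsStart, Gen.cod]
  | cap b =>
    obtain ⟨_, h⟩ := h
    cases b <;> simp [orient] at h <;> simp [h, IsStart, Gen.dom]
  | cross a b o =>
    rcases h with ⟨_, h⟩ | ⟨_, h⟩ | ⟨_, h⟩ <;> cases a <;> cases b <;> cases o <;>
      simp [orient] at h <;> simp [h, IsStart, Gen.dom, Gen.cod]

/-- The steps along the vertical strands with the signs `l`, at the positions from `i` on at the
bottom and from `j` on at the top. -/
def VerticalStep (l : List Bool) (i j : ℕ) (x : End) (τ : Turn) (y : End) : Prop :=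
  ∃ p b, l[p]? = some b ∧ τ = .free ∧ (x, y) = orient b (.bot (i + p)) (.top (j + p))

theorem Slice.isStep_iff {s : Slice} {x y : End} {τ : Turn} : s.IsStep x τ y ↔
    VerticalStep s.left 0 0 x τ y ∨
    (∃ x' y', s.gen.IsStep x' τ y' ∧ x = x'.shift s.left.length ∧ y = y'.shift s.left.length) ∨
    VerticalStep s.right (s.left.length + s.gen.dom.length) (s.left.length + s.gen.cod.length)
      x τ y := by
  simp only [VerticalStep, zero_add]
  rfl

theorem fan_verticalStep (l : List Bool) (i j : ℕ) (x : End) : Fan (VerticalStep l i j x) := by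
  cases x with
  | bot q =>
    by_cases h : ∃ p, q = i + p ∧ l[p]? = some true
    · obtain ⟨p, rfl, hp⟩ := h
      refine .inr (.inl ⟨.free, .top (j + p), .inl rfl, fun τ y => ⟨?_, ?_⟩⟩)
      · rintro ⟨p', b, hb, rfl, h⟩
        cases b <;> simp [orient] at h
        obtain ⟨rfl, rfl⟩ := h
        simp
      · rintro ⟨rfl, rfl⟩
        exact ⟨p, true, hp, rfl, rfl⟩
    · refine .inl ?_
      rintro τ y ⟨p', b, hb, rfl, h'⟩
      cases b <;> simp [orient] at h'
      exact h ⟨p', h'.1, hb⟩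
  | top q =>
    by_cases h : ∃ p, q = j + p ∧ l[p]? = some false
    · obtain ⟨p, rfl, hp⟩ := h
      refine .inr (.inl ⟨.free, .bot (i + p), .inl rfl, fun τ y => ⟨?_, ?_⟩⟩)
      · rintro ⟨p', b, hb, rfl, h⟩
        cases b <;> simp [orient] at h
        obtain ⟨rfl, rfl⟩ := h
        simp
      · rintro ⟨rfl, rfl⟩
        exact ⟨p, false, hp, rfl, rfl⟩
    · refine .inl ?_
      rintro τ y ⟨p', b, hb, rfl, h'⟩
      cases b <;> simp [orient] at h'
      exact h ⟨p', h'.1, hb⟩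

theorem End.shift_injective (k : ℕ) : Function.Injective (End.shift k) := by
  rintro (p | p) (q | q) h <;> simp [End.shift] at h <;> simp [h]

theorem fan_shift {R : End → Turn → End → Prop} (hR : ∀ x, Fan (R x)) (k : ℕ) (x : End) :
    Fan (fun (τ : Turn) (y : End) => ∃ x' y' : End, R x' τ y' ∧ x = x'.shift k ∧ y = End.shift k y') := by
  by_cases h : ∃ x' : End, x = x'.shift k
  · obtain ⟨x', rfl⟩ := h
    have e : (fun (τ : Turn) (y : End) => ∃ x'' y' : End, R x'' τ y' ∧ x'.shift k = x''.shift k ∧ y = y'.shift k) =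
        fun τ y => ∃ y', R x' τ y' ∧ y = y'.shift k := by
      funext τ y
      apply propext
      constructor
      · rintro ⟨x'', y', h, h', rfl⟩
        rw [End.shift_injective k h']
        exact ⟨y', h, rfl⟩
      · rintro ⟨y', h, rfl⟩
        exact ⟨x', y', h, rfl, rfl⟩
    rw [e]
    rcases hR x' with h | ⟨τ, y, hτ, h⟩ | ⟨b, y, z, h⟩
    · exact .inl (by simp [h])
    · exact .inr (.inl ⟨τ, y.shift k, hτ, by simp [h]⟩)
    · refine .inr (.inr ⟨b, y.shift k, z.shift k, fun τ' y' => ?_⟩)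
      simp only [h]
      grind
  · push Not at h
    exact .inl (by simp [h])

theorem VerticalStep.bounds {l : List Bool} {i j : ℕ} {x y : End} {τ : Turn}
    (h : VerticalStep l i j x τ y) : ∃ p < l.length,
      (x = .bot (i + p) ∧ l[p]? = some true) ∨ (x = .top (j + p) ∧ l[p]? = some false) := by
  obtain ⟨p, b, hb, _, h⟩ := h
  obtain ⟨hp, _⟩ := List.getElem?_eq_some_iff.1 hb
  refine ⟨p, hp, ?_⟩
  cases b <;> simp [orient] at h <;> simp [h, hb]

theorem IsStart.bounds {lower upper : List Bool} {x : End} (h : IsStart lower upper x) :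
    ∃ p, (x = .bot p ∧ p < lower.length) ∨ (x = .top p ∧ p < upper.length) := by
  cases x with
  | bot p => exact ⟨p, .inl ⟨rfl, (List.getElem?_eq_some_iff.1 h).1⟩⟩
  | top p => exact ⟨p, .inr ⟨rfl, (List.getElem?_eq_some_iff.1 h).1⟩⟩

theorem Slice.fan (s : Slice) (x : End) : Fan (s.IsStep x) := by
  have e : s.IsStep x = fun τ y => VerticalStep s.left 0 0 x τ y ∨
      ((∃ x' y', s.gen.IsStep x' τ y' ∧ x = x'.shift s.left.length ∧
        y = y'.shift s.left.length) ∨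
      VerticalStep s.right (s.left.length + s.gen.dom.length) (s.left.length + s.gen.cod.length)
        x τ y) := by
    funext τ y; exact propext Slice.isStep_iff
  rw [e]
  refine (fan_verticalStep _ _ _ _).or ((fan_shift s.gen.fan _ _).or (fan_verticalStep _ _ _ _) ?_)
    ?_
  · rintro τ y τ' y' ⟨x', _, h, rfl, rfl⟩ h'
    obtain ⟨p, hp⟩ := h.isStart.bounds
    obtain ⟨q, hq, h'⟩ := h'.bounds
    rcases hp with ⟨rfl, hp⟩ | ⟨rfl, hp⟩ <;> simp [End.shift] at h' <;> omega
  · rintro τ y τ' y' h h'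
    obtain ⟨q, hq, h⟩ := h.bounds
    rcases h' with ⟨x', _, h', rfl, rfl⟩ | h'
    · obtain ⟨p, hp⟩ := h'.isStart.bounds
      rcases hp with ⟨rfl, hp⟩ | ⟨rfl, hp⟩ <;> simp [End.shift] at h <;> omega
    · obtain ⟨p, hp, h'⟩ := h'.bounds
      rcases h with ⟨rfl, h⟩ | ⟨rfl, h⟩ <;> simp at h' <;> omega

theorem Slice.IsStep.isStart {s : Slice} {x y : End} {τ : Turn} (h : s.IsStep x τ y) :
    IsStart s.dom s.cod x := by
  rw [Slice.isStep_iff] at h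
  rcases h with h | ⟨x', y', h, rfl, rfl⟩ | h
  · obtain ⟨p, hp, ⟨rfl, h⟩ | ⟨rfl, h⟩⟩ := h.bounds <;>
      simp only [IsStart, Slice.dom, Slice.cod] <;> grind
  · have h := h.isStart
    obtain ⟨p, ⟨rfl, hp⟩ | ⟨rfl, hp⟩⟩ := h.bounds <;>
      simpa [IsStart, End.shift, Slice.dom, Slice.cod, List.getElem?_append, hp] using h
  · obtain ⟨p, hp, ⟨rfl, h⟩ | ⟨rfl, h⟩⟩ := h.bounds <;>
      simp only [IsStart, Slice.dom, Slice.cod] <;> grind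

/-! ### Colourings and harmonic functions -/

/-- The labels of the first `k` positions. -/
def row (f : ℕ → ℂ) (k : ℕ) : List ℂ := (List.range k).map f

theorem row_add (f : ℕ → ℂ) (i j : ℕ) : row f (i + j) = row f i ++ row (fun p => f (i + p)) j := by
  simp [row, List.range_add, Function.comp_def]

theorem length_row (f : ℕ → ℂ) (k : ℕ) : (row f k).length = k := by simp [row]

theorem row_eq_row {f g : ℕ → ℂ} {k : ℕ} : row f k = row g k ↔ ∀ p < k, f p = g p := by
  simp [row]

theorem mean_crossing (t : ℂ) (o u : End × End) (b : Bool) (h : End → ℂ) :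
    (∀ x, Mean t (fun τ y => (τ = Turn.under ∧ (x, y) = u) ∨ (τ = .straight b ∧ (x, y) = o) ∨
      (τ = .drop b ∧ (x, y) = (o.1, u.2))) h (h x)) ↔
    h u.1 = h u.2 ∧ h o.1 =
      Turn.weight t (.straight b) * h o.2 + Turn.weight t (.drop b) * h u.2 := by
  obtain ⟨o1, o2⟩ := o
  obtain ⟨u1, u2⟩ := u
  constructor
  · intro H
    exact ⟨(H u1).2.1 u2 (by simp), (H o1).2.2 b o2 u2 (by simp) (by simp)⟩
  · rintro ⟨h1, h2⟩ x
    refine ⟨by simp, ?_, ?_⟩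
    · simp only [true_and, reduceCtorEq, false_and, or_false, Prod.mk.injEq]
      rintro y ⟨rfl, rfl⟩
      exact h1
    · simp only [reduceCtorEq, Turn.straight.injEq, Turn.drop.injEq, Prod.mk.injEq, false_and,
        false_or, or_false]
      rintro b y z ⟨rfl, rfl, rfl⟩ ⟨-, -, rfl⟩
      exact h2

/-- The mean value equation at the start of the over-strand is solved for the upper end of this
strand. The power of `t` depends only on the direction of the under-strand: reversing the
over-strand changes the sign of the crossing, but also exchanges the known end with the sought one.
-/
theorem Gen.colors_iff {t : ℂ} (ht : t ≠ 0) (g : Gen) (h : End → ℂ) :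
    g.Colors t (row (fun p => h (.bot p)) g.dom.length) (row (fun p => h (.top p)) g.cod.length) ↔
      ∀ x, Mean t (g.IsStep x) h (h x) := by
  have r2 : ∀ f : ℕ → ℂ, row f 2 = [f 0, f 1] := fun _ => rfl
  have r0 : ∀ f : ℕ → ℂ, row f 0 = [] := fun _ => rfl
  cases g with
  | cup b =>
    simp only [Gen.dom, Gen.cod, List.length_cons, List.length_nil, Gen.Colors, zero_add,
      Nat.reduceAdd, r2, r0]
    cases b <;> simp [Mean, Gen.IsStep, orient] <;> grind
  | cap b =>
    simp only [Gen.dom, Gen.cod, List.length_cons, List.length_nil, Gen.Colors, zero_add,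
      Nat.reduceAdd, r2, r0]
    cases b <;> simp [Mean, Gen.IsStep, orient] <;> grind
  | cross a b o =>
    refine Iff.trans ?_ (mean_crossing t _ _ _ h).symm
    simp only [Gen.dom, Gen.cod, List.length_cons, List.length_nil, Gen.Colors, zero_add,
      Nat.reduceAdd, r2]
    cases a <;> cases b <;> cases o <;>
      simp [orient, crossLeft, crossRight, Turn.weight] <;> grind

theorem Slice.mean_iff {t : ℂ} (s : Slice) (h : End → ℂ) :
    (∀ x, Mean t (s.IsStep x) h (h x)) ↔
      (∀ p < s.left.length, h (.bot p) = h (.top p)) ∧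
      (∀ x, Mean t (s.gen.IsStep x) (fun y => h (y.shift s.left.length))
        (h (x.shift s.left.length))) ∧
      ∀ p < s.right.length, h (.bot (s.left.length + (s.gen.dom.length + p))) =
        h (.top (s.left.length + (s.gen.cod.length + p))) := by
  have vert : ∀ (l : List Bool) (i j : ℕ), (∀ x y, VerticalStep l i j x .free y → h x = h y) ↔
      ∀ p < l.length, h (.bot (i + p)) = h (.top (j + p)) := by
    intro l i j
    constructor
    · intro H p hp
      cases hb : l[p]
      · exact (H _ _ ⟨p, false, by simp [hb, hp], rfl, rfl⟩).symm
      · exact H _ _ ⟨p, true, by simp [hb, hp], rfl, rfl⟩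
    · rintro H x y ⟨p, b, hb, -, hxy⟩
      have hp := (List.getElem?_eq_some_iff.1 hb).1
      cases b <;> simp [orient] at hxy <;> simp [hxy, H p hp]
  have vert0 := vert s.left 0 0
  simp only [zero_add] at vert0
  rw [← vert0]
  have vert1 := vert s.right (s.left.length + s.gen.dom.length) (s.left.length + s.gen.cod.length)
  simp only [Nat.add_assoc] at vert1
  rw [← vert1]
  constructor
  · intro H
    refine ⟨fun x y hxy => (H x).1 y (Slice.isStep_iff.2 (.inl hxy)), fun x => ⟨?_, ?_, ?_⟩,
      fun x y hxy => (H x).1 y (Slice.isStep_iff.2 (.inr (.inr (by simpa only [Nat.add_assoc]))))⟩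
    · intro y hy
      exact (H _).1 _ (Slice.isStep_iff.2 (.inr (.inl ⟨x, y, hy, rfl, rfl⟩)))
    · intro y hy
      exact (H _).2.1 _ (Slice.isStep_iff.2 (.inr (.inl ⟨x, y, hy, rfl, rfl⟩)))
    · intro b y z hy hz
      exact (H _).2.2 b _ _ (Slice.isStep_iff.2 (.inr (.inl ⟨x, y, hy, rfl, rfl⟩)))
        (Slice.isStep_iff.2 (.inr (.inl ⟨x, z, hz, rfl, rfl⟩)))
  · rintro ⟨H1, H2, H3⟩ x
    refine ⟨?_, ?_, ?_⟩
    · intro y hy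
      rcases Slice.isStep_iff.1 hy with hy | ⟨x, y, hy', rfl, rfl⟩ | hy
      · exact H1 x y hy
      · exact (H2 x).1 y hy'
      · exact H3 x y (by simpa only [Nat.add_assoc] using hy)
    · intro y hy
      rcases Slice.isStep_iff.1 hy with ⟨p, b, _, hf, _⟩ | ⟨x, y, hy', rfl, rfl⟩ | ⟨p, b, _, hf, _⟩
      · cases hf
      · exact (H2 x).2.1 y hy'
      · cases hf
    · intro b y z hy hz
      rcases Slice.isStep_iff.1 hy with ⟨p, b, _, hf, _⟩ | ⟨x, y, hy', rfl, rfl⟩ | ⟨p, b, _, hf, _⟩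
      · cases hf
      · rcases Slice.isStep_iff.1 hz with ⟨p, b, _, hf, _⟩ | ⟨x', z, hz', hx, rfl⟩ |
          ⟨p, b, _, hf, _⟩
        · cases hf
        · obtain rfl := End.shift_injective _ hx
          exact (H2 x).2.2 b y z hy' hz'
        · cases hf
      · cases hf

theorem Slice.colors_iff {t : ℂ} (ht : t ≠ 0) (s : Slice) (h : End → ℂ) :
    s.Colors t (row (fun p => h (.bot p)) s.dom.length) (row (fun p => h (.top p)) s.cod.length) ↔
      ∀ x, Mean t (s.IsStep x) h (h x) := by
  rw [Slice.mean_iff]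
  have hg := Gen.colors_iff ht s.gen (fun y => h (y.shift s.left.length))
  rw [← hg]
  simp only [← row_eq_row, End.shift]
  have e1 : s.dom.length = s.left.length + (s.gen.dom.length + s.right.length) := by
    simp [Slice.dom]
  have e2 : s.cod.length = s.left.length + (s.gen.cod.length + s.right.length) := by
    simp [Slice.cod]
  rw [e1, e2]
  simp only [row_add]
  constructor
  · rintro ⟨l, r, g, g', hl, hr, hc, hx, hy⟩
    obtain ⟨h1, hx⟩ := List.append_inj hx (by rw [length_row, hl])
    obtain ⟨h2, h3⟩ := List.append_inj hx (by rw [length_row, hc.length_dom])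
    obtain ⟨h1', hy⟩ := List.append_inj hy (by rw [length_row, hl])
    obtain ⟨h2', h3'⟩ := List.append_inj hy (by rw [length_row, hc.length_cod])
    refine ⟨h1.trans h1'.symm, ?_, h3.trans h3'.symm⟩
    rw [← h2, ← h2'] at hc
    exact hc
  · rintro ⟨h1, h2, h3⟩
    exact ⟨_, _, _, _, length_row _ _, length_row _ _, h2, rfl, by rw [h1, h3]⟩

/-! ### Sums over the paths of a quiver -/

section Paths

variable {V : Type*} [Quiver V]

/-- A path is trivial or consists of a first step and a path. -/
def joinStep {P Q : V} : PLift (P = Q) ⊕ (Σ e : (Σ P', P ⟶ P'), Quiver.Path e.1 Q) →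
    Quiver.Path P Q
  | .inl ⟨h⟩ => h ▸ .nil
  | .inr ⟨e, p⟩ => e.2.toPath.comp p

/-- `Quiver.Path` grows at its far end, while harmonicity concerns the first step; the recursion
therefore descends to the initial edge. -/
def splitStep {P : V} : ∀ {Q : V}, Quiver.Path P Q →
    PLift (P = Q) ⊕ (Σ e : (Σ P', P ⟶ P'), Quiver.Path e.1 Q)
  | _, .nil => .inl ⟨rfl⟩
  | _, .cons p f => match splitStep p with
    | .inl ⟨h⟩ => .inr ⟨⟨_, h ▸ f⟩, .nil⟩
    | .inr ⟨e, q⟩ => .inr ⟨e, q.cons f⟩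

theorem splitStep_comp {P Q : V} (e : Σ P', P ⟶ P') (p : Quiver.Path e.1 Q) :
    splitStep (e.2.toPath.comp p) = .inr ⟨e, p⟩ := by
  induction p with
  | nil => rfl
  | cons p f ih =>
    rw [Quiver.Path.comp_cons]
    simp only [splitStep]
    rw [ih]

theorem joinStep_splitStep {P Q : V} (p : Quiver.Path P Q) : joinStep (splitStep p) = p := by
  induction p with
  | nil => rfl
  | cons p f ih =>
    simp only [splitStep]
    revert ih
    rcases splitStep p with ⟨⟨rfl⟩⟩ | ⟨e, q⟩
    · intro ih
      rw [← ih]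
      rfl
    · intro ih
      rw [← ih]
      rfl

def stepEquiv (P Q : V) : Quiver.Path P Q ≃
    PLift (P = Q) ⊕ (Σ e : (Σ P', P ⟶ P'), Quiver.Path e.1 Q) where
  toFun := splitStep
  invFun := joinStep
  left_inv := joinStep_splitStep
  right_inv := by
    rintro (⟨⟨rfl⟩⟩ | ⟨e, p⟩)
    · rfl
    · exact splitStep_comp e p

theorem tsum_path {α : Type*} [AddCommMonoid α] [TopologicalSpace α] [ContinuousAdd α]
    [T3Space α] {P Q : V} (f : Quiver.Path P Q → α)
    (hinl : Summable fun i => f (joinStep (.inl i)))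
    (hinr : Summable fun i => f (joinStep (.inr i)))
    (hstep : ∀ e : Σ P', P ⟶ P', Summable fun p : Quiver.Path e.1 Q => f (e.2.toPath.comp p)) :
    ∑' p, f p = ∑' i, f (joinStep (.inl i)) +
      ∑' e : Σ P', P ⟶ P', ∑' p : Quiver.Path e.1 Q, f (e.2.toPath.comp p) := by
  have h1 := hinr.tsum_sigma' hstep
  rw [← (stepEquiv P Q).symm.tsum_eq f]
  simp only [joinStep] at h1
  rw [← h1]
  exact Summable.tsum_sum (f := fun i => f (joinStep i)) hinl hinr

open Classical in
theorem tsum_trivial_path {α : Type*} [AddCommMonoid α] [TopologicalSpace α] {P Q : V}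
    (f : ∀ {P Q : V}, Quiver.Path P Q → α) :
    ∑' i : PLift (P = Q), f (joinStep (.inl i)) =
      if P = Q then f (Quiver.Path.nil : Quiver.Path P P) else 0 := by
  split_ifs with h
  · subst h
    have : Unique (PLift (P = P)) := ⟨⟨⟨rfl⟩⟩, fun _ => rfl⟩
    rw [tsum_eq_single ⟨rfl⟩ (fun b hb => (hb (Subsingleton.elim _ _)).elim)]
    rfl
  · have : IsEmpty (PLift (P = Q)) := ⟨fun i => h i.down⟩
    exact tsum_empty

variable {w : ∀ {P P' : V}, (P ⟶ P') → ℂ} {v : V → ℝ≥0∞}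

theorem weight_toPath_comp {P P' Q : V} (e : P ⟶ P') (p : Quiver.Path P' Q) :
    (e.toPath.comp p).weight w = w e * p.weight w := by
  simp [Quiver.Path.weight_comp, Quiver.Hom.toPath]

open Classical in
/-- If the function `v` is at least halved by the steps, then it bounds the sums over paths. -/
theorem tsum_enorm_weight_le (hv₁ : ∀ P, 1 ≤ v P)
    (hv : ∀ P, ∑' e : Σ P', P ⟶ P', ‖w e.2‖ₑ * v e.1 ≤ v P / 2) (P Q : V) :
    ∑' p : Quiver.Path P Q, ‖p.weight w‖ₑ ≤ 2 * v P := by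
  -- Truncation by length allows an induction: the trivial path contributes at most `1 ≤ v P`, and
  -- the paths with a first step at most `2 * (v P / 2)`.
  have bound : ∀ (k : ℕ) (P : V),
      ∑' p : Quiver.Path P Q, (if p.length < k then ‖p.weight w‖ₑ else 0) ≤ 2 * v P := by
    intro k
    induction k with
    | zero => simp
    | succ k ih =>
      intro P
      rw [tsum_path _ ENNReal.summable ENNReal.summable fun _ => ENNReal.summable]
      have h1 := tsum_trivial_path (P := P) (Q := Q)
        (f := fun p => if p.length < k + 1 then ‖p.weight w‖ₑ else 0)
      rw [h1]
      have h2 : ∑' (e : Σ P', P ⟶ P') (p : Quiver.Path e.1 Q),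
          (if (e.2.toPath.comp p).length < k + 1 then ‖(e.2.toPath.comp p).weight w‖ₑ else 0) ≤
          v P := by
        calc _ ≤ ∑' e : Σ P', P ⟶ P', 2 * (‖w e.2‖ₑ * v e.1) := by
              refine ENNReal.tsum_le_tsum fun e => ?_
              calc _ = ‖w e.2‖ₑ * ∑' p : Quiver.Path e.1 Q,
                    (if p.length < k then ‖p.weight w‖ₑ else 0) := by
                    rw [← ENNReal.tsum_mul_left]
                    refine tsum_congr fun p => ?_
                    rw [Quiver.Path.length_comp, weight_toPath_comp, enorm_mul]
                    simp [Quiver.Path.length_toPath, add_comm 1]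
                _ ≤ _ := by
                    rw [mul_left_comm]
                    gcongr
                    exact ih e.1
          _ = 2 * ∑' e : Σ P', P ⟶ P', ‖w e.2‖ₑ * v e.1 := ENNReal.tsum_mul_left
          _ ≤ 2 * (v P / 2) := by gcongr; exact hv P
          _ = v P := ENNReal.mul_div_cancel (by simp) (by simp)
      calc _ ≤ 1 + v P := by
            gcongr
            split_ifs <;> simp
        _ ≤ v P + v P := by gcongr; exact hv₁ P
        _ = 2 * v P := (two_mul _).symm
  -- The paths of a finite set have bounded length, so one truncated sum dominates.
  rw [ENNReal.tsum_eq_iSup_sum]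
  refine iSup_le fun s => ?_
  refine le_trans ?_ (bound (s.sup Quiver.Path.length + 1) P)
  refine le_trans (Finset.sum_le_sum fun p hp => ?_) (ENNReal.sum_le_tsum s)
  rw [if_pos (Nat.lt_succ_of_le (Finset.le_sup (f := Quiver.Path.length) hp))]

theorem summable_weight (hv₁ : ∀ P, 1 ≤ v P) (hv₂ : ∀ P, v P ≠ ∞)
    (hv : ∀ P, ∑' e : Σ P', P ⟶ P', ‖w e.2‖ₑ * v e.1 ≤ v P / 2) (P Q : V) :
    Summable fun p : Quiver.Path P Q => p.weight w :=
  .of_enorm (ne_top_of_le_ne_top (ENNReal.mul_ne_top (by simp) (hv₂ P))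
    (tsum_enorm_weight_le hv₁ hv P Q))

-- First-step analysis: the path sums are harmonic up to a source at `Q`, which is due to the
-- trivial path.
open Classical in
theorem tsum_weight_eq (hv₁ : ∀ P, 1 ≤ v P) (hv₂ : ∀ P, v P ≠ ∞)
    (hv : ∀ P, ∑' e : Σ P', P ⟶ P', ‖w e.2‖ₑ * v e.1 ≤ v P / 2) (P Q : V) :
    ∑' p : Quiver.Path P Q, p.weight w = (if P = Q then 1 else 0) +
      ∑' e : Σ P', P ⟶ P', w e.2 * ∑' p : Quiver.Path e.1 Q, p.weight w := by
  have hs := summable_weight hv₁ hv₂ hv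
  have hs' : Summable fun i => (joinStep (P := P) (Q := Q) i).weight w :=
    (stepEquiv P Q).symm.summable_iff.2 (hs P Q)
  rw [tsum_path (fun p => p.weight w) (hs'.comp_injective Sum.inl_injective)
    (hs'.comp_injective Sum.inr_injective)]
  · have h1 := tsum_trivial_path (P := P) (Q := Q) (f := fun p => p.weight w)
    rw [h1]
    simp only [weight_toPath_comp, tsum_mul_left, Quiver.Path.weight_nil]
  · intro e
    simp only [weight_toPath_comp]
    exact (hs e.1 Q).mul_left _

/-- Every application of `hg` halves the bound `C * v`, by `hv`, and iteration leaves only `0`.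
Applied to a difference, this is the uniqueness of bounded harmonic functions. -/
theorem eq_zero_of_le_tsum (hv₂ : ∀ P, v P ≠ ∞)
    (hv : ∀ P, ∑' e : Σ P', P ⟶ P', ‖w e.2‖ₑ * v e.1 ≤ v P / 2) (g : V → ℂ) (C : ℝ≥0∞)
    (hC : C ≠ ∞) (hgC : ∀ P, ‖g P‖ₑ ≤ C * v P)
    (hg : ∀ P, ‖g P‖ₑ ≤ ∑' e : Σ P', P ⟶ P', ‖w e.2‖ₑ * ‖g e.1‖ₑ) (P : V) : g P = 0 := by
  have bound : ∀ (k : ℕ) (P : V), ‖g P‖ₑ ≤ 2⁻¹ ^ k * (C * v P) := by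
    intro k
    induction k with
    | zero => simpa using hgC
    | succ k ih =>
      intro P
      calc _ ≤ ∑' e : Σ P', P ⟶ P', ‖w e.2‖ₑ * ‖g e.1‖ₑ := hg P
        _ ≤ ∑' e : Σ P', P ⟶ P', 2⁻¹ ^ k * C * (‖w e.2‖ₑ * v e.1) := by
            refine ENNReal.tsum_le_tsum fun e => ?_
            calc _ ≤ ‖w e.2‖ₑ * (2⁻¹ ^ k * (C * v e.1)) := by gcongr; exact ih e.1
              _ = _ := by ring
        _ = 2⁻¹ ^ k * C * ∑' e : Σ P', P ⟶ P', ‖w e.2‖ₑ * v e.1 := ENNReal.tsum_mul_left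
        _ ≤ 2⁻¹ ^ k * C * (v P / 2) := by gcongr; exact hv P
        _ = _ := by rw [ENNReal.div_eq_inv_mul]; ring
  have lim : Filter.Tendsto (fun k : ℕ => (2⁻¹ : ℝ≥0∞) ^ k * (C * v P)) .atTop (nhds 0) := by
    have := ENNReal.Tendsto.mul_const (b := C * v P)
      (ENNReal.tendsto_pow_atTop_nhds_zero_of_lt_one (r := 2⁻¹) (by simp))
      (.inr (ENNReal.mul_ne_top hC (hv₂ P)))
    simpa using this
  have := ge_of_tendsto' lim fun k => bound k P
  simpa using this

open Classical in
/-- A bounded harmonic function with value `1` at `Q` and `0` at the other ends of the quiver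
computes the sums over the paths to `Q`. -/
theorem hasSum_weight [∀ P : V, Finite (Σ P', P ⟶ P')] (hv₁ : ∀ P, 1 ≤ v P)
    (hv₂ : ∀ P, v P ≠ ∞)
    (hv : ∀ P, ∑' e : Σ P', P ⟶ P', ‖w e.2‖ₑ * v e.1 ≤ v P / 2) (Q : V) (h : V → ℂ) (C : ℝ≥0∞)
    (hC : C ≠ ∞) (hb : ∀ P, ‖h P‖ₑ ≤ C)
    (hh : ∀ P, h P = (if P = Q then 1 else 0) + ∑' e : Σ P', P ⟶ P', w e.2 * h e.1) (P : V) :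
    HasSum (fun p : Quiver.Path P Q => p.weight w) (h P) := by
  -- In the difference the source at `Q` cancels. The path sum contributes `2 * v` to the bound and
  -- `h` contributes `C ≤ C * v`.
  have key : ∀ P, (∑' p : Quiver.Path P Q, p.weight w) - h P = 0 := by
    refine eq_zero_of_le_tsum hv₂ hv (fun P => (∑' p : Quiver.Path P Q, p.weight w) - h P)
      (2 + C) (by simp [hC]) (fun P => ?_) fun P => ?_
    · calc _ ≤ ‖∑' p : Quiver.Path P Q, p.weight w‖ₑ + ‖h P‖ₑ := enorm_sub_le
        _ ≤ 2 * v P + C * v P := by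
            gcongr
            · exact enorm_tsum_le_tsum_enorm.trans (tsum_enorm_weight_le hv₁ hv P Q)
            · exact (hb P).trans (le_mul_of_one_le_right (by simp) (hv₁ P))
        _ = _ := (add_mul _ _ _).symm
    · have e : (∑' p : Quiver.Path P Q, p.weight w) - h P =
          ∑' e : Σ P', P ⟶ P', w e.2 * ((∑' p : Quiver.Path e.1 Q, p.weight w) - h e.1) := by
        rw [tsum_weight_eq hv₁ hv₂ hv, hh P, add_sub_add_left_eq_sub, ← Summable.tsum_sub
          (Summable.of_finite) (Summable.of_finite)]
        simp only [mul_sub]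
      rw [e]
      refine enorm_tsum_le_tsum_enorm.trans (le_of_eq ?_)
      simp only [enorm_mul]
  rw [← sub_eq_zero.1 (key P)]
  exact (summable_weight hv₁ hv₂ hv P Q).hasSum

end Paths

/-! ### From slices to whole diagrams -/

theorem Composable.dom_getElem?_succ {ε δ : List Bool} {w : List Slice} (h : Composable ε w δ)
    {ℓ : ℕ} {s s' : Slice} (hs : w[ℓ]? = some s) (hs' : w[ℓ + 1]? = some s') : s'.dom = s.cod := by
  induction w generalizing ε ℓ with
  | nil => simp at hs
  | cons u w ih =>
    cases ℓ with
    | zero =>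
      cases w with
      | nil => simp at hs'
      | cons u' w =>
        simp at hs hs'
        subst hs hs'
        exact h.2.1
    | succ ℓ => exact ih h.2 (by simpa using hs) (by simpa using hs')

theorem Composable.dom_getElem?_zero {ε δ : List Bool} {w : List Slice} (h : Composable ε w δ)
    {s : Slice} (hs : w[0]? = some s) : s.dom = ε := by
  cases w with
  | nil => simp at hs
  | cons u w =>
    simp at hs
    subst hs
    exact h.1

theorem Composable.cod_getElem?_last {ε δ : List Bool} {w : List Slice} (h : Composable ε w δ)
    {ℓ : ℕ} {s : Slice} (hs : w[ℓ]? = some s) (hℓ : ℓ + 1 = w.length) : s.cod = δ := by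
  induction w generalizing ε ℓ with
  | nil => simp at hs
  | cons u w ih =>
    cases w with
    | nil =>
      simp at hℓ
      subst hℓ
      simp at hs
      subst hs
      exact h.2
    | cons u' w =>
      cases ℓ with
      | zero => simp at hℓ
      | succ ℓ => exact ih h.2 (by simpa using hs) (by simpa using hℓ)

namespace TangleDiagram

variable {ε δ : List Bool} {D : TangleDiagram ε δ}

theorem signs_eq_dom {ℓ : ℕ} {s : Slice} (hs : D.word[ℓ]? = some s) : D.signs ℓ = s.dom := by
  obtain ⟨hℓ, -⟩ := List.getElem?_eq_some_iff.1 hs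
  simp [signs, hs, hℓ.ne]

theorem signs_length : D.signs D.word.length = δ := by simp [signs]

theorem signs_succ {ℓ : ℕ} {s : Slice} (hs : D.word[ℓ]? = some s) : D.signs (ℓ + 1) = s.cod := by
  obtain ⟨hℓ, -⟩ := List.getElem?_eq_some_iff.1 hs
  rcases Nat.lt_or_ge (ℓ + 1) D.word.length with h | h
  · have hs' : D.word[ℓ + 1]? = some D.word[ℓ + 1] := List.getElem?_eq_getElem h
    rw [signs_eq_dom hs', D.composable.dom_getElem?_succ hs hs']
  · have e : ℓ + 1 = D.word.length := by omega
    rw [e, signs_length, D.composable.cod_getElem?_last hs e]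

theorem signs_zero : D.signs 0 = ε := by
  rcases Nat.eq_zero_or_pos D.word.length with h | h
  · have hc := D.composable
    rw [List.length_eq_zero_iff.1 h] at hc
    have h' := D.signs_length
    rw [h] at h'
    exact h'.trans hc.symm
  · have hs : D.word[0]? = some D.word[0] := List.getElem?_eq_getElem h
    rw [signs_eq_dom hs, D.composable.dom_getElem?_zero hs]

theorem signs_of_length_lt {ℓ : ℕ} (h : D.word.length < ℓ) : D.signs ℓ = [] := by
  simp [signs, h.ne', List.getElem?_eq_none h.le]

theorem pointOfEnd_injective (ℓ : ℕ) : Function.Injective (D.pointOfEnd ℓ) := by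
  rintro (p | p) (q | q) h <;> simp [pointOfEnd, Point.ext_iff] at h <;> simp [h]

/-- A point on an inner line is an end of the slice below and of the slice above, but its sign
decides where its strand goes on: upwards for `true`, downwards for `false`. Hence all steps from a
point lie in a single slice. -/
theorem pointOfEnd_eq {ℓ ℓ' : ℕ} {s s' : Slice} {x x' : End} (hs : D.word[ℓ]? = some s)
    (hs' : D.word[ℓ']? = some s') (hx : IsStart s.dom s.cod x) (hx' : IsStart s'.dom s'.cod x')
    (h : D.pointOfEnd ℓ x = D.pointOfEnd ℓ' x') : ℓ = ℓ' ∧ s = s' ∧ x = x' := by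
  suffices hℓ : ℓ = ℓ' by
    subst hℓ
    exact ⟨rfl, by simpa [hs] using hs', pointOfEnd_injective ℓ h⟩
  cases x with
  | bot p =>
    cases x' with
    | bot p' => exact (Point.ext_iff.1 h).1
    | top p' =>
      obtain ⟨h1, h2⟩ := Point.ext_iff.1 h
      simp only [pointOfEnd] at h1 h2
      subst h1 h2
      rw [IsStart, D.composable.dom_getElem?_succ hs' hs] at hx
      rw [IsStart, hx] at hx'
      simp at hx'
  | top p =>
    cases x' with
    | top p' =>
      have := (Point.ext_iff.1 h).1
      simp only [pointOfEnd] at this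
      omega
    | bot p' =>
      obtain ⟨h1, h2⟩ := Point.ext_iff.1 h
      simp only [pointOfEnd] at h1 h2
      subst h1 h2
      rw [IsStart, D.composable.dom_getElem?_succ hs hs'] at hx'
      rw [IsStart, hx'] at hx
      simp at hx

theorem isStep_pointOfEnd {ℓ : ℕ} {s : Slice} {x : End} (hs : D.word[ℓ]? = some s)
    (hx : IsStart s.dom s.cod x) (τ : Turn) (P' : Point D) :
    D.IsStep (D.pointOfEnd ℓ x) τ P' ↔ ∃ y, s.IsStep x τ y ∧ P' = D.pointOfEnd ℓ y := by
  constructor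
  · rintro ⟨ℓ', s', x', y', hs', hstep, h, rfl⟩
    obtain ⟨rfl, rfl, rfl⟩ := pointOfEnd_eq hs hs' hx hstep.isStart h
    exact ⟨y', hstep, rfl⟩
  · rintro ⟨y, hstep, rfl⟩
    exact ⟨ℓ, s, x, y, hs, hstep, rfl, rfl⟩

theorem fan (P : Point D) : Fan (D.IsStep P) := by
  by_cases h : ∃ τ P', D.IsStep P τ P'
  · obtain ⟨τ, P', ℓ, s, x, y, hs, hstep, rfl, rfl⟩ := h
    have key := isStep_pointOfEnd hs hstep.isStart
    rcases s.fan x with h | ⟨τ, y, hτ, h⟩ | ⟨b, y, z, h⟩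
    · exact (h _ _ hstep).elim
    · exact .inr (.inl ⟨τ, D.pointOfEnd ℓ y, hτ, by simp [key, h]⟩)
    · refine .inr (.inr ⟨b, D.pointOfEnd ℓ y, D.pointOfEnd ℓ z, fun τ' y' => ?_⟩)
      rw [key]
      simp only [h]
      grind
  · push Not at h
    exact .inl h

theorem isPoint_of_isStep {P P' : Point D} {τ : Turn} (h : D.IsStep P τ P') : D.IsPoint P := by
  obtain ⟨ℓ, s, x, y, hs, hstep, rfl, rfl⟩ := h
  cases x with
  | bot p =>
    have := (List.getElem?_eq_some_iff.1 hstep.isStart).1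
    simpa [IsPoint, pointOfEnd, signs_eq_dom hs] using this
  | top p =>
    have := (List.getElem?_eq_some_iff.1 hstep.isStart).1
    simpa [IsPoint, pointOfEnd, signs_succ hs] using this

theorem mean_iff {t : ℂ} (h : Point D → ℂ) : (∀ P, Mean t (D.IsStep P) h (h P)) ↔
    ∀ ℓ s, D.word[ℓ]? = some s → ∀ x,
      Mean t (s.IsStep x) (fun y => h (D.pointOfEnd ℓ y)) (h (D.pointOfEnd ℓ x)) := by
  constructor
  · intro H ℓ s hs x
    have step : ∀ τ y, s.IsStep x τ y → D.IsStep (D.pointOfEnd ℓ x) τ (D.pointOfEnd ℓ y) :=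
      fun τ y hy => ⟨ℓ, s, x, y, hs, hy, rfl, rfl⟩
    exact ⟨fun y hy => (H _).1 _ (step _ _ hy), fun y hy => (H _).2.1 _ (step _ _ hy),
      fun b y z hy hz => (H _).2.2 b _ _ (step _ _ hy) (step _ _ hz)⟩
  · intro H P
    refine ⟨?_, ?_, ?_⟩
    · rintro _ ⟨ℓ, s, x, y, hs, hstep, rfl, rfl⟩
      exact (H ℓ s hs x).1 y hstep
    · rintro _ ⟨ℓ, s, x, y, hs, hstep, rfl, rfl⟩
      exact (H ℓ s hs x).2.1 y hstep
    · rintro b _ Q ⟨ℓ, s, x, y, hs, hstep, rfl, rfl⟩ hQ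
      obtain ⟨z, hz, rfl⟩ := (isStep_pointOfEnd hs hstep.isStart _ _).1 hQ
      exact (H ℓ s hs x).2.2 b y z hstep hz

end TangleDiagram

/-! ### Colourings as functions on the points of a diagram -/

theorem colored_iff {t : ℂ} {w : List Slice} {x y : List ℂ} {tr : List (List ℂ)} :
    Colored t w x y tr ↔ ∃ f : ℕ → List ℂ, x = f 0 ∧ y = f w.length ∧
      tr = (List.range w.length).map f ∧
      ∀ (ℓ : ℕ) (s : Slice), w[ℓ]? = some s → s.Colors t (f ℓ) (f (ℓ + 1)) := by
  induction w generalizing x tr with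
  | nil =>
    constructor
    · rintro ⟨rfl, rfl⟩
      exact ⟨fun _ => x, by simp⟩
    · rintro ⟨f, rfl, rfl, rfl, -⟩
      exact ⟨rfl, rfl⟩
  | cons s w ih =>
    constructor
    · rintro ⟨z, tr', hs, h, rfl⟩
      obtain ⟨f, rfl, rfl, rfl, hf⟩ := ih.1 h
      refine ⟨fun ℓ => ℓ.casesOn x f, rfl, rfl, ?_, ?_⟩
      · simp [List.range_succ_eq_map, Function.comp_def]
      · rintro (_ | ℓ) s' hs'
        · simp at hs'
          subst hs'
          exact hs
        · exact hf ℓ s' (by simpa using hs')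
    · rintro ⟨f, rfl, rfl, rfl, hf⟩
      refine ⟨f 1, (List.range w.length).map fun ℓ => f (ℓ + 1), hf 0 s rfl,
        ih.2 ⟨fun ℓ => f (ℓ + 1), rfl, rfl, rfl, fun ℓ s' hs' => hf (ℓ + 1) s' (by simpa)⟩,
        ?_⟩
      simp [List.range_succ_eq_map, Function.comp_def]

theorem row_getD (l : List ℂ) : row (fun p => l.getD p 0) l.length = l := by
  apply List.ext_getElem
  · simp [row]
  · intro i h1 h2
    simp [row, h2]

namespace TangleDiagram

variable {ε δ : List Bool} {D : TangleDiagram ε δ}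

/-- The labels on the line of level `ℓ`. -/
def labels (D : TangleDiagram ε δ) (h : Point D → ℂ) (ℓ : ℕ) : List ℂ :=
  row (fun p => h ⟨ℓ, p⟩) (D.signs ℓ).length

theorem colored_labels {t : ℂ} (ht : t ≠ 0) {h : Point D → ℂ}
    (hh : ∀ P, Mean t (D.IsStep P) h (h P)) :
    Colored t D.word (D.labels h 0) (D.labels h D.word.length)
      ((List.range D.word.length).map (D.labels h)) := by
  refine colored_iff.2 ⟨D.labels h, rfl, rfl, rfl, fun ℓ s hs => ?_⟩
  have := (s.colors_iff ht fun y => h (D.pointOfEnd ℓ y)).2 ((mean_iff h).1 hh ℓ s hs)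
  rwa [labels, labels, signs_eq_dom hs, signs_succ hs]

/-- Off the diagram the value `0` is harmless, since no step starts there, and it keeps the function
bounded. -/
theorem exists_mean {t : ℂ} (ht : t ≠ 0) {x y : List ℂ} {tr : List (List ℂ)}
    (hx : x.length = ε.length) (hc : Colored t D.word x y tr) :
    ∃ h : Point D → ℂ, (∀ P, Mean t (D.IsStep P) h (h P)) ∧ (∀ P, ¬ D.IsPoint P → h P = 0) ∧
      x = D.labels h 0 ∧ y = D.labels h D.word.length ∧
      tr = (List.range D.word.length).map (D.labels h) := by
  obtain ⟨f, rfl, rfl, rfl, hf⟩ := colored_iff.1 hc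
  have len : ∀ ℓ ≤ D.word.length, (f ℓ).length = (D.signs ℓ).length := by
    intro ℓ hℓ
    cases ℓ with
    | zero => rw [hx, signs_zero]
    | succ ℓ =>
      have hs : D.word[ℓ]? = some D.word[ℓ] := List.getElem?_eq_getElem hℓ
      rw [(hf ℓ _ hs).length_cod, signs_succ hs]
  let h : Point D → ℂ := fun P =>
    if P.level ≤ D.word.length then (f P.level).getD P.position 0 else 0
  have lab : ∀ ℓ ≤ D.word.length, f ℓ = D.labels h ℓ := by
    intro ℓ hℓ
    simp only [labels, h, if_pos hℓ, ← len ℓ hℓ, row_getD]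
  refine ⟨h, ?_, ?_, lab 0 (Nat.zero_le _), lab _ le_rfl, ?_⟩
  · rw [mean_iff]
    intro ℓ s hs
    have hℓ := (List.getElem?_eq_some_iff.1 hs).1
    have hc := hf ℓ s hs
    rw [lab ℓ hℓ.le, lab (ℓ + 1) hℓ, labels, labels, signs_eq_dom hs, signs_succ hs] at hc
    exact (s.colors_iff ht fun y => h (D.pointOfEnd ℓ y)).1 hc
  · intro P hP
    simp only [h]
    split_ifs with hl
    · simp only [IsPoint, not_lt, ← len _ hl] at hP
      simp [List.getD_eq_getElem?_getD, List.getElem?_eq_none hP]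
    · rfl
  · refine List.map_congr_left fun ℓ hℓ => lab ℓ (List.mem_range.1 hℓ).le

theorem finite_isPoint (D : TangleDiagram ε δ) : {P : Point D | D.IsPoint P}.Finite := by
  have : {P : Point D | D.IsPoint P} ⊆ ⋃ ℓ ∈ Finset.range (D.word.length + 1),
      (fun p => (⟨ℓ, p⟩ : Point D)) '' Set.Iio (D.signs ℓ).length := by
    intro P hP
    have hl : P.level < D.word.length + 1 := by
      by_contra hl
      have hP : P.position < (D.signs P.level).length := hP
      simp [signs_of_length_lt (by omega : D.word.length < P.level)] at hP
    simp only [Set.mem_iUnion, Finset.mem_range, Set.mem_image]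
    exact ⟨P.level, hl, P.position, hP, rfl⟩
  refine Set.Finite.subset ?_ this
  exact Set.Finite.biUnion (Finset.finite_toSet _) fun ℓ _ => (Set.finite_Iio _).image _

end TangleDiagram

/-! ### Sums over the steps from a point -/

section Fan

variable {V α : Type*} [AddCommMonoid α] [TopologicalSpace α] {R : Turn → V → Prop}

theorem finite_of_fan (h : Fan R) : Finite (Σ y, {τ // R τ y}) := by
  let f : (Σ y, {τ // R τ y}) → Turn × V := fun e => (e.2.1, e.1)
  have hf : Function.Injective f := by
    rintro ⟨y, τ, h⟩ ⟨y', τ', h'⟩ he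
    simp only [f, Prod.mk.injEq] at he
    obtain ⟨rfl, rfl⟩ := he
    rfl
  rcases h with h | ⟨τ, y, -, h⟩ | ⟨b, y, z, h⟩
  · have : IsEmpty (Σ y, {τ // R τ y}) := ⟨fun e => h _ _ e.2.2⟩
    infer_instance
  · refine Set.finite_univ_iff.1 (Set.Finite.of_finite_image (f := f) ?_ hf.injOn)
    refine Set.Finite.subset (Set.finite_singleton (τ, y)) ?_
    rintro _ ⟨⟨y', τ', h'⟩, -, rfl⟩
    simpa [f] using (h _ _).1 h'
  · refine Set.finite_univ_iff.1 (Set.Finite.of_finite_image (f := f) ?_ hf.injOn)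
    refine Set.Finite.subset (Set.toFinite {(.straight b, y), (.drop b, z)}) ?_
    rintro _ ⟨⟨y', τ', h'⟩, -, rfl⟩
    simpa [f] using (h _ _).1 h'

theorem tsum_of_single {τ : Turn} {y : V} (h : ∀ τ' y', R τ' y' ↔ τ' = τ ∧ y' = y)
    (G : Turn → V → α) : ∑' e : (Σ y, {τ // R τ y}), G e.2.1 e.1 = G τ y := by
  refine tsum_eq_single (⟨y, τ, (h _ _).2 ⟨rfl, rfl⟩⟩ : Σ y, {τ // R τ y}) ?_
  rintro ⟨y', τ', h'⟩ hne
  obtain ⟨rfl, rfl⟩ := (h _ _).1 h'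
  exact (hne rfl).elim

theorem tsum_of_pair {b : Bool} {y z : V}
    (h : ∀ τ' y', R τ' y' ↔ (τ' = .straight b ∧ y' = y) ∨ (τ' = .drop b ∧ y' = z))
    (G : Turn → V → α) : ∑' e : (Σ y, {τ // R τ y}), G e.2.1 e.1 =
      G (.straight b) y + G (.drop b) z := by
  classical
  let e₁ : Σ y, {τ // R τ y} := ⟨y, .straight b, (h _ _).2 (.inl ⟨rfl, rfl⟩)⟩
  let e₂ : Σ y, {τ // R τ y} := ⟨z, .drop b, (h _ _).2 (.inr ⟨rfl, rfl⟩)⟩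
  have hne : e₁ ≠ e₂ := by
    intro he
    have := congrArg (fun e : Σ y, {τ // R τ y} => e.2.1) he
    simp [e₁, e₂] at this
  rw [tsum_eq_sum (s := {e₁, e₂}), Finset.sum_pair hne]
  rintro ⟨y', τ', h'⟩ hn
  rcases (h _ _).1 h' with ⟨rfl, rfl⟩ | ⟨rfl, rfl⟩ <;> simp [e₁, e₂] at hn

/-- At a point without steps `Mean` imposes nothing whereas the sum is `0`; this is why a step has
to exist. -/
theorem Mean.eq_tsum {t : ℂ} {h : V → ℂ} {c : ℂ} (hR : Fan R) (hc : Mean t R h c)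
    (hex : ∃ τ y, R τ y) : c = ∑' e : (Σ y, {τ // R τ y}), Turn.weight t e.2.1 * h e.1 := by
  rcases hR with hR | ⟨τ, y, hτ, hR⟩ | ⟨b, y, z, hR⟩
  · obtain ⟨τ, y, hy⟩ := hex
    exact (hR _ _ hy).elim
  · rw [tsum_of_single hR (fun τ y => Turn.weight t τ * h y)]
    have hy := (hR τ y).2 ⟨rfl, rfl⟩
    rcases hτ with rfl | rfl
    · simpa [Turn.weight] using hc.1 y hy
    · simpa [Turn.weight] using hc.2.1 y hy
  · rw [tsum_of_pair hR (fun τ y => Turn.weight t τ * h y)]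
    exact hc.2.2 b y z ((hR _ _).2 (.inl ⟨rfl, rfl⟩)) ((hR _ _).2 (.inr ⟨rfl, rfl⟩))

theorem mean_of_eq_tsum {t : ℂ} {h : V → ℂ} {c : ℂ} (hR : Fan R)
    (hc : (∃ τ y, R τ y) → c = ∑' e : (Σ y, {τ // R τ y}), Turn.weight t e.2.1 * h e.1) :
    Mean t R h c := by
  rcases hR with hR | ⟨τ, y, hτ, hR⟩ | ⟨b, y, z, hR⟩
  · exact ⟨fun y hy => (hR _ _ hy).elim, fun y hy => (hR _ _ hy).elim,
      fun b y z hy => (hR _ _ hy).elim⟩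
  · rw [tsum_of_single hR (fun τ y => Turn.weight t τ * h y)] at hc
    have hc := hc ⟨τ, y, (hR _ _).2 ⟨rfl, rfl⟩⟩
    simp only [Mean, hR]
    rcases hτ with rfl | rfl <;> simp [hc, Turn.weight]
  · rw [tsum_of_pair hR (fun τ y => Turn.weight t τ * h y)] at hc
    have hc := hc ⟨_, y, (hR _ _).2 (.inl ⟨rfl, rfl⟩)⟩
    simp only [Mean, hR]
    refine ⟨by simp, by simp, ?_⟩
    rintro b' y' z' (⟨h1, rfl⟩ | ⟨h1, -⟩) (⟨h2, -⟩ | ⟨h2, rfl⟩) <;> cases h1 <;> cases h2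
    exact hc

end Fan

/-! ### Steps exist -/

theorem Gen.exists_isStep {g : Gen} {x : End} (h : IsStart g.dom g.cod x) :
    ∃ τ y, g.IsStep x τ y := by
  cases g with
  | cup b =>
    rcases x with (_ | _ | p) | (_ | _ | p) <;> cases b <;>
      simp [IsStart, Gen.dom, Gen.cod, Gen.IsStep, orient] at h ⊢
  | cap b =>
    rcases x with (_ | _ | p) | (_ | _ | p) <;> cases b <;>
      simp [IsStart, Gen.dom, Gen.cod, Gen.IsStep, orient] at h ⊢
  | cross a b o =>
    rcases x with (_ | _ | p) | (_ | _ | p) <;> cases a <;> cases b <;> cases o <;>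
      simp [IsStart, Gen.dom, Gen.cod, Gen.IsStep, orient] at h ⊢ <;>
      first
      | exact ⟨.under, _, .inl ⟨rfl, rfl⟩⟩
      | exact ⟨.straight _, _, .inl ⟨rfl, rfl⟩⟩

theorem Slice.exists_isStep {s : Slice} {x : End} (h : IsStart s.dom s.cod x) :
    ∃ τ y, s.IsStep x τ y := by
  simp only [Slice.isStep_iff]
  cases x with
  | bot p =>
    simp only [IsStart, Slice.dom, List.append_assoc] at h
    rcases Nat.lt_or_ge p s.left.length with h1 | h1
    · rw [List.getElem?_append_left h1] at h
      exact ⟨.free, .top p, .inl ⟨p, true, h, rfl, by simp [orient]⟩⟩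
    · obtain ⟨p, rfl⟩ := Nat.exists_eq_add_of_le h1
      rw [List.getElem?_append_right h1, Nat.add_sub_cancel_left] at h
      rcases Nat.lt_or_ge p s.gen.dom.length with h2 | h2
      · rw [List.getElem?_append_left h2] at h
        obtain ⟨τ, y, hy⟩ := Gen.exists_isStep (g := s.gen) (x := .bot p) h
        exact ⟨τ, y.shift _, .inr (.inl ⟨.bot p, y, hy, rfl, rfl⟩)⟩
      · obtain ⟨p, rfl⟩ := Nat.exists_eq_add_of_le h2
        rw [List.getElem?_append_right h2, Nat.add_sub_cancel_left] at h
        exact ⟨.free, _, .inr (.inr ⟨p, true, h, rfl, by simp [orient, Nat.add_assoc]; rfl⟩)⟩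
  | top p =>
    simp only [IsStart, Slice.cod, List.append_assoc] at h
    rcases Nat.lt_or_ge p s.left.length with h1 | h1
    · rw [List.getElem?_append_left h1] at h
      exact ⟨.free, .bot p, .inl ⟨p, false, h, rfl, by simp [orient]⟩⟩
    · obtain ⟨p, rfl⟩ := Nat.exists_eq_add_of_le h1
      rw [List.getElem?_append_right h1, Nat.add_sub_cancel_left] at h
      rcases Nat.lt_or_ge p s.gen.cod.length with h2 | h2
      · rw [List.getElem?_append_left h2] at h
        obtain ⟨τ, y, hy⟩ := Gen.exists_isStep (g := s.gen) (x := .top p) h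
        exact ⟨τ, y.shift _, .inr (.inl ⟨.top p, y, hy, rfl, rfl⟩)⟩
      · obtain ⟨p, rfl⟩ := Nat.exists_eq_add_of_le h2
        rw [List.getElem?_append_right h2, Nat.add_sub_cancel_left] at h
        exact ⟨.free, _, .inr (.inr ⟨p, false, h, rfl, by simp [orient, Nat.add_assoc]; rfl⟩)⟩

namespace TangleDiagram

variable {n : ℕ} {D : TangleDiagram (pos n) (pos n)}

theorem not_isStep_top (p : ℕ) (τ : Turn) (P' : Point D) : ¬ D.IsStep (D.top p) τ P' := by
  rintro ⟨ℓ, s, x, y, hs, hstep, h, rfl⟩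
  have hℓ := (List.getElem?_eq_some_iff.1 hs).1
  have hx := hstep.isStart
  cases x with
  | bot q =>
    have := (Point.ext_iff.1 h).1
    simp only [pointOfEnd, top] at this
    omega
  | top q =>
    have := (Point.ext_iff.1 h).1
    simp only [pointOfEnd, top] at this
    rw [IsStart, ← signs_succ hs, ← this, signs_length, List.getElem?_eq_some_iff] at hx
    simp at hx

theorem exists_isStep {P : Point D} (hP : D.IsPoint P) (hl : P.level ≠ D.word.length) :
    ∃ τ P', D.IsStep P τ P' := by
  obtain ⟨ℓ, p⟩ := P
  simp only [IsPoint] at hP hl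
  have hle : ℓ < D.word.length := by
    by_contra h
    rw [signs_of_length_lt (by omega)] at hP
    simp at hP
  cases hb : (D.signs ℓ)[p] with
  | true =>
    have hs : D.word[ℓ]? = some D.word[ℓ] := List.getElem?_eq_getElem hle
    have hst : IsStart (D.word[ℓ]).dom (D.word[ℓ]).cod (.bot p) := by
      rw [IsStart, ← signs_eq_dom hs, List.getElem?_eq_getElem hP, hb]
    obtain ⟨τ, y, hy⟩ := Slice.exists_isStep hst
    exact ⟨τ, _, ℓ, _, _, y, hs, hy, rfl, rfl⟩
  | false =>
    cases ℓ with
    -- A downward strand at the bottom line would be a dead end, but all bottom signs are `true`.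
    | zero => simp [signs_zero] at hb
    | succ ℓ =>
      have hs : D.word[ℓ]? = some D.word[ℓ] := List.getElem?_eq_getElem (by omega)
      have hst : IsStart (D.word[ℓ]).dom (D.word[ℓ]).cod (.top p) := by
        rw [IsStart, ← signs_succ hs, List.getElem?_eq_getElem hP, hb]
      obtain ⟨τ, y, hy⟩ := Slice.exists_isStep hst
      exact ⟨τ, _, ℓ, _, _, y, hs, hy, rfl, rfl⟩

/-! ### Rigid diagrams -/

/-- At `t = 1` going straight on has weight `1` and dropping has weight `0`, so nothing is left but
transport along the strand. -/
theorem Follows.eq_of_mean {h : Point D → ℂ} {P P' : Point D} (hP : Mean 1 (D.IsStep P) h (h P))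
    (hf : D.Follows P P') : h P = h P' := by
  obtain ⟨τ, hτ, hs⟩ := hf
  rcases D.fan P with hR | ⟨τ, y, hτ', hR⟩ | ⟨b, y, z, hR⟩
  · exact (hR _ _ hs).elim
  · obtain ⟨rfl, rfl⟩ := (hR _ _).1 hs
    rcases hτ' with rfl | rfl
    · exact hP.1 _ hs
    · exact hP.2.1 _ hs
  · rcases (hR _ _).1 hs with ⟨rfl, rfl⟩ | ⟨rfl, -⟩
    · simpa [Turn.weight] using hP.2.2 b _ z hs ((hR _ _).2 (.inr ⟨rfl, rfl⟩))
    · exact (hτ b rfl).elim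

theorem Follows.unique {P P' P'' : Point D} (h : D.Follows P P') (h' : D.Follows P P'') :
    P' = P'' := by
  obtain ⟨τ, hτ, hs⟩ := h
  obtain ⟨τ', hτ', hs'⟩ := h'
  rcases D.fan P with hR | ⟨_, y, -, hR⟩ | ⟨b, y, z, hR⟩
  · exact (hR _ _ hs).elim
  · exact ((hR _ _).1 hs).2.trans ((hR _ _).1 hs').2.symm
  · rcases (hR _ _).1 hs with ⟨rfl, rfl⟩ | ⟨rfl, -⟩
    · rcases (hR _ _).1 hs' with ⟨rfl, rfl⟩ | ⟨rfl, -⟩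
      · rfl
      · exact (hτ' b rfl).elim
    · exact (hτ b rfl).elim

theorem isZeroRow_labels {h : Point D → ℂ} {ℓ : ℕ} :
    IsZeroRow (D.labels h ℓ) ↔ ∀ p, D.IsPoint ⟨ℓ, p⟩ → h ⟨ℓ, p⟩ = 0 := by
  simp [IsZeroRow, labels, row, IsPoint]

theorem isPoint_top {p : ℕ} : D.IsPoint (D.top p) ↔ p < n := by
  simp [IsPoint, top, signs_length]

/-- Each point is joined to a top point by its strand, along which a colouring at `t = 1` is
constant. Rigidity refers to colourings only, so in contrast to the condition on components its
invariance needs no tracing of strands through the moves. -/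
theorem IsStringLink.rigid (hD : D.IsStringLink) : Rigid (pos n) D.word := by
  intro x y tr hx hc hy
  obtain ⟨h, hm, -, -, rfl, rfl⟩ := exists_mean one_ne_zero hx hc
  intro z hz
  obtain ⟨ℓ, hℓ, rfl⟩ := List.mem_map.1 hz
  rw [isZeroRow_labels] at hy ⊢
  intro p hp
  obtain ⟨i, j, -, hj⟩ := hD _ hp
  have along : ∀ P Q : Point D, Relation.ReflTransGen D.Follows P Q → h P = h Q := by
    intro P Q hPQ
    induction hPQ with
    | refl => rfl
    | tail _ hf ih => exact ih.trans (Follows.eq_of_mean (hm _) hf)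
  rw [along _ _ hj]
  exact hy _ (isPoint_top.2 j.2)

/-- Following the strand from the point, one arrives at its end in less than `k` steps. -/
def Dies (D : TangleDiagram (pos n) (pos n)) : ℕ → Point D → Prop
  | 0, _ => False
  | k + 1, P => ∀ P', D.Follows P P' → Dies D k P'

/-- The indicator function of the points whose strand never ends is constant along strands, hence
harmonic at `t = 1`, and it vanishes at the top. By rigidity it is zero. -/
theorem exists_dies (hr : Rigid (pos n) D.word) (P : Point D) : ∃ k, Dies D k P := by
  classical
  let h : Point D → ℂ := fun P => if ∃ k, Dies D k P then 0 else 1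
  have hf : ∀ P P', D.Follows P P' → h P = h P' := by
    intro P P' hf
    have : (∃ k, Dies D k P) ↔ ∃ k, Dies D k P' := by
      constructor
      · rintro ⟨_ | k, hk⟩
        · exact hk.elim
        · exact ⟨k, hk P' hf⟩
      · rintro ⟨k, hk⟩
        exact ⟨k + 1, fun P'' hf' => hf.unique hf' ▸ hk⟩
    simp only [h, this]
  have hm : ∀ P, Mean 1 (D.IsStep P) h (h P) := by
    refine fun P => ⟨fun y hy => hf _ _ ⟨_, by simp, hy⟩, fun y hy => hf _ _ ⟨_, by simp, hy⟩,
      fun b y z hy _ => ?_⟩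
    rw [hf P y ⟨_, by simp, hy⟩]
    simp [Turn.weight]
  have top : ∀ p, h (D.top p) = 0 := fun p =>
    if_pos ⟨1, fun P' ⟨τ, _, hs⟩ => (not_isStep_top p τ P' hs).elim⟩
  have key := hr _ _ _ (by simp [labels, length_row, signs_zero]) (colored_labels one_ne_zero hm)
    (isZeroRow_labels.2 fun p _ => top p)
  by_contra hP
  have hP1 : h P = 1 := if_neg hP
  have hpt : D.IsPoint P := by
    by_contra hn
    exact hP ⟨1, fun P' ⟨τ, _, hs⟩ => (hn (isPoint_of_isStep hs)).elim⟩
  have hl : P.level < D.word.length := by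
    by_contra hl
    rcases Nat.eq_or_lt_of_le (not_lt.1 hl) with hl | hl
    · have : P = D.top P.position := Point.ext hl.symm rfl
      rw [this, top] at hP1
      exact zero_ne_one hP1
    · simp [IsPoint, signs_of_length_lt hl] at hpt
  have := isZeroRow_labels.1 (key _ (List.mem_map.2 ⟨P.level, List.mem_range.2 hl, rfl⟩))
    P.position hpt
  rw [hP1] at this
  exact one_ne_zero this

/-- There is a bounded function on the points that decreases along the strands. -/
theorem exists_height (hr : Rigid (pos n) D.word) : ∃ (d : Point D → ℕ) (N : ℕ),
    (∀ P P', D.Follows P P' → d P' < d P) ∧ ∀ P, d P ≤ N := by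
  classical
  refine ⟨fun P => Nat.find (exists_dies hr P), ?_⟩
  obtain ⟨N, hN⟩ := (D.finite_isPoint.image fun P => Nat.find (exists_dies hr P)).bddAbove
  -- `N` bounds the heights of the finitely many points on the diagram; elsewhere no step starts and
  -- the height is at most `1`.
  refine ⟨max N 1, ?_, ?_⟩
  · intro P P' hf
    have hP := Nat.find_spec (exists_dies hr P)
    show Nat.find (exists_dies hr P') < Nat.find (exists_dies hr P)
    cases hk : Nat.find (exists_dies hr P) with
    | zero =>
      rw [hk] at hP
      exact hP.elim
    | succ k =>
      rw [hk] at hP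
      exact Nat.lt_succ_of_le (Nat.find_min' (exists_dies hr P') (hP P' hf))
  · intro P
    by_cases hP : D.IsPoint P
    · exact le_max_of_le_left (hN ⟨P, hP, rfl⟩)
    · refine le_max_of_le_right (Nat.find_min' _ ?_)
      exact fun P' ⟨τ, _, hs⟩ => (hP (isPoint_of_isStep hs)).elim

/-! ### Convergence near `t = 1` -/

theorem IsStep.follows {P P' : Point D} {τ : Turn} (h : D.IsStep P τ P')
    (hτ : ∀ b, τ ≠ .drop b) : D.Follows P P' :=
  ⟨τ, hτ, h⟩

theorem eventually_weight_le (M : ℝ≥0∞) (hM : M ≠ ∞) : ∀ᶠ t in 𝓝 (1 : ℂ), t ≠ 0 ∧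
    ∀ b, ‖Turn.weight t (.straight b)‖ₑ ≤ 2 ∧ ‖Turn.weight t (.drop b)‖ₑ * M ≤ 1 := by
  have hid : Tendsto (fun t : ℂ => t) (𝓝 1) (𝓝 1) := tendsto_id
  have hinv : Tendsto (fun t : ℂ => t⁻¹) (𝓝 1) (𝓝 1) := by
    simpa using tendsto_inv₀ (one_ne_zero (α := ℂ))
  have h1 : ∀ f : ℂ → ℂ, Tendsto f (𝓝 1) (𝓝 1) → ∀ᶠ t in 𝓝 (1 : ℂ),
      ‖f t‖ₑ ≤ 2 ∧ ‖1 - f t‖ₑ * M ≤ 1 := by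
    intro f hf
    have e1 : ∀ᶠ t in 𝓝 (1 : ℂ), ‖f t‖ₑ < 2 :=
      hf.enorm.eventually_lt_const (by simp)
    have l2 : Tendsto (fun t => ‖1 - f t‖ₑ * M) (𝓝 1) (𝓝 (‖(1 : ℂ) - 1‖ₑ * M)) :=
      ENNReal.Tendsto.mul_const (tendsto_const_nhds.sub hf).enorm (.inr hM)
    have e2 : ∀ᶠ t in 𝓝 (1 : ℂ), ‖1 - f t‖ₑ * M < 1 := l2.eventually_lt_const (by simp)
    filter_upwards [e1, e2] with t h1 h2 using ⟨h1.le, h2.le⟩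
  filter_upwards [h1 _ hid, h1 _ hinv, eventually_ne_nhds one_ne_zero] with t ht ht' h0
  refine ⟨h0, fun b => ?_⟩
  cases b
  · simpa [Turn.weight] using ht'
  · simpa [Turn.weight] using ht

/-- Let `y` be the next point along the strand. Going straight contributes at most `2 * 8 ^ d y`. A
drop may land at any height up to `N`, but its weight absorbs `8 ^ N`, so it contributes at most `1
≤ 2 * 8 ^ d y`. As `d y < d P`, the sum `4 * 8 ^ d y` is at most `8 ^ d P / 2`, which accounts for
the base `8`. -/
theorem tsum_weight_mul_le {t : ℂ} {d : Point D → ℕ} {N : ℕ}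
    (hd : ∀ P P', D.Follows P P' → d P' < d P) (hN : ∀ P, d P ≤ N)
    (ht : ∀ b, ‖Turn.weight t (.straight b)‖ₑ ≤ 2 ∧ ‖Turn.weight t (.drop b)‖ₑ * 8 ^ N ≤ 1)
    (P : Point D) :
    ∑' e : (Σ P', {τ // D.IsStep P τ P'}), ‖Turn.weight t e.2.1‖ₑ * (8 : ℝ≥0∞) ^ d e.1 ≤
      8 ^ d P / 2 := by
  have half : ∀ P', D.Follows P P' → 4 * (8 : ℝ≥0∞) ^ d P' ≤ 8 ^ d P / 2 := by
    intro P' hf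
    rw [ENNReal.le_div_iff_mul_le (by simp) (by simp)]
    calc 4 * (8 : ℝ≥0∞) ^ d P' * 2 = 8 ^ (d P' + 1) := by rw [pow_succ]; ring
      _ ≤ 8 ^ d P := pow_le_pow_right₀ (by norm_num) (hd P P' hf)
  rcases D.fan P with hR | ⟨τ, y, hτ, hR⟩ | ⟨b, y, z, hR⟩
  · have : IsEmpty (Σ P', {τ // D.IsStep P τ P'}) := ⟨fun e => hR _ _ e.2.2⟩
    simp
  · rw [tsum_of_single hR fun τ y => ‖Turn.weight t τ‖ₑ * (8 : ℝ≥0∞) ^ d y]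
    have hs := (hR _ _).2 ⟨rfl, rfl⟩
    have hw : ‖Turn.weight t τ‖ₑ = 1 := by rcases hτ with rfl | rfl <;> simp [Turn.weight]
    rw [hw]
    refine le_trans ?_ (half y (IsStep.follows hs (by rcases hτ with rfl | rfl <;> simp)))
    gcongr
    norm_num
  · rw [tsum_of_pair hR fun τ y => ‖Turn.weight t τ‖ₑ * (8 : ℝ≥0∞) ^ d y]
    have hs := (hR _ _).2 (.inl ⟨rfl, rfl⟩)
    refine le_trans ?_ (half y (IsStep.follows hs (by simp)))
    calc _ ≤ 2 * (8 : ℝ≥0∞) ^ d y + ‖Turn.weight t (.drop b)‖ₑ * 8 ^ N := by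
          gcongr
          · exact (ht b).1
          · norm_num
          · exact hN z
      _ ≤ 2 * (8 : ℝ≥0∞) ^ d y + 1 := by gcongr; exact (ht b).2
      _ ≤ 2 * (8 : ℝ≥0∞) ^ d y + 2 * 8 ^ d y := by
          gcongr
          calc (1 : ℝ≥0∞) ≤ 2 * 1 := by norm_num
            _ ≤ _ := by gcongr; exact one_le_pow₀ (by norm_num)
      _ = 4 * (8 : ℝ≥0∞) ^ d y := by ring

/-- The row with the label `1` at position `j` and `0` elsewhere. -/
def unitRow (n j : ℕ) : List ℂ := row (fun p => if p = j then 1 else 0) n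

theorem labels_length {h : Point D → ℂ} :
    D.labels h D.word.length = row (fun p => h (D.top p)) n := by
  simp [labels, signs_length, top]

theorem labels_zero {h : Point D → ℂ} : D.labels h 0 = row (fun p => h (D.bottom p)) n := by
  simp [labels, signs_zero, bottom]

/-- Near `t = 1`, the sums over the paths to a top point of a rigid diagram converge, and they are
the labels of the unique colouring with label `1` at this point and `0` at the other top points. -/
theorem eventually_hasSum (hr : Rigid (pos n) D.word) : ∀ᶠ t in 𝓝 (1 : ℂ), ∀ j : Fin n,
    (∃ x tr, x.length = n ∧ Colored t D.word x (unitRow n j) tr) ∧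
    ∀ x tr, x.length = n → Colored t D.word x (unitRow n j) tr → ∀ i : Fin n,
      HasSum (fun γ : D.AdmissiblePath (D.bottom i) (D.top j) => D.pathWeight t γ)
        (x.getD i 0) := by
  classical
  obtain ⟨d, N, hd, hN⟩ := exists_height hr
  filter_upwards [eventually_weight_le (8 ^ N) (by simp)] with t ⟨ht0, ht⟩ j
  have hfin : ∀ P : Point D, Finite (Σ P', P ⟶ P') := fun P => finite_of_fan (D.fan P)
  have hv := tsum_weight_mul_le hd hN ht
  have hv₁ : ∀ P, 1 ≤ (8 : ℝ≥0∞) ^ d P := fun P => one_le_pow₀ (by norm_num)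
  have hv₂ : ∀ P, (8 : ℝ≥0∞) ^ d P ≠ ∞ := fun P => by simp
  constructor
  -- Existence: the path sums themselves are the colouring. No step leaves a top point, so only the
  -- trivial path counts there and the top row is the unit row.
  · let W : Point D → ℂ := fun P => ∑' γ : D.AdmissiblePath P (D.top j), D.pathWeight t γ
    have hW : ∀ P, W P = (if P = D.top j then 1 else 0) +
        ∑' e : (Σ P', {τ // D.IsStep P τ P'}), Turn.weight t e.2.1 * W e.1 := fun P =>
      tsum_weight_eq (w := fun {P P' : Point D} (e : P ⟶ P') => Turn.weight t e.1) hv₁ hv₂ hv P _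
    have hm : ∀ P, Mean t (D.IsStep P) W (W P) := by
      refine fun P => mean_of_eq_tsum (D.fan P) fun ⟨τ, P', hs⟩ => ?_
      have hne : P ≠ D.top j := by
        rintro rfl
        exact not_isStep_top _ _ _ hs
      simpa [hne] using hW P
    have hc := colored_labels ht0 hm
    have e : D.labels W D.word.length = unitRow n j := by
      rw [labels_length, unitRow, row_eq_row]
      intro p hp
      have : IsEmpty (Σ P', {τ // D.IsStep (D.top p) τ P'}) :=
        ⟨fun e => not_isStep_top _ _ _ e.2.2⟩
      rw [hW, tsum_empty, add_zero]
      simp [top, Point.ext_iff]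
    rw [e] at hc
    exact ⟨D.labels W 0, _, by simp [labels_zero, length_row], hc⟩
  -- Uniqueness: every such colouring, extended by `0`, is a bounded harmonic function with source
  -- at the `j`-th top point, hence gives the path sums.
  · intro x tr hx hc i
    obtain ⟨h, hm, hz, rfl, hy, -⟩ := exists_mean ht0 (by simpa using hx) hc
    rw [labels_length, unitRow, row_eq_row] at hy
    obtain ⟨C, hC⟩ := (D.finite_isPoint.image fun P => ‖h P‖₊).bddAbove
    have key := hasSum_weight (w := fun {P P' : Point D} (e : P ⟶ P') => Turn.weight t e.1)
      hv₁ hv₂ hv (D.top j) h C (by simp) (fun P => ?_) (fun P => ?_) (D.bottom i)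
    · have e : (D.labels h 0).getD i 0 = h (D.bottom i) := by
        simp [labels_zero, row]
      rw [e]
      exact key
    · by_cases hP : D.IsPoint P
      · rw [enorm_eq_nnnorm]
        exact_mod_cast hC ⟨P, hP, rfl⟩
      · simp [hz P hP]
    · by_cases hex : ∃ τ P', D.IsStep P τ P'
      · have hne : P ≠ D.top j := by
          rintro rfl
          obtain ⟨τ, P', hs⟩ := hex
          exact not_isStep_top _ _ _ hs
        rw [if_neg hne, zero_add]
        exact (hm P).eq_tsum (D.fan P) hex
      · have : IsEmpty (Σ P', P ⟶ P') := ⟨fun e => hex ⟨_, _, e.2.2⟩⟩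
        rw [tsum_empty, add_zero]
        -- A point without steps lies on the top line, where the unit row prescribes the value, or
        -- off the diagram, where the value is `0`.
        by_cases hP : D.IsPoint P
        · have hl : P.level = D.word.length := by
            by_contra hl
            exact hex (exists_isStep hP hl)
          obtain ⟨ℓ, p⟩ := P
          obtain rfl : ℓ = D.word.length := hl
          refine (hy p (isPoint_top.1 hP)).symm.trans ?_
          simp [top, Point.ext_iff]
        · have hne : P ≠ D.top j := by
            rintro rfl
            exact hP (isPoint_top.2 j.2)
          rw [hz P hP, if_neg hne]

end TangleDiagram

/-! ### Colourings of the partial closure of a braid -/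

open Matrix in
theorem vecMul_burauMatrix {R : Type*} [CommRing R] (t : R) (N : ℕ) (i : Fin (N - 1))
    (v : Fin N → R) (c : Fin N) : (v ᵥ* burauMatrix t N i) c =
      if (c : ℕ) = i then (1 - t) * v ⟨i, by omega⟩ + t * v ⟨i + 1, by omega⟩
      else if (c : ℕ) = i + 1 then v ⟨i, by omega⟩ else v c := by
  have key : (fun r => burauMatrix t N i r c) =
      if (c : ℕ) = i then (1 - t) • Pi.single ⟨i, by omega⟩ 1 + t • Pi.single ⟨i + 1, by omega⟩ 1
      else if (c : ℕ) = i + 1 then Pi.single ⟨i, by omega⟩ 1 else Pi.single c 1 := by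
    funext r
    simp only [burauMatrix]
    split_ifs <;> simp_all [Pi.single_apply, Fin.ext_iff]
  change v ⬝ᵥ (fun r => burauMatrix t N i r c) = _
  rw [key]
  split_ifs <;> simp only [dotProduct_add, dotProduct_smul, dotProduct_single, mul_one, smul_eq_mul]

open Matrix in
theorem vecMul_burauMatrixInv {R : Type*} [CommRing R] (t' : R) (N : ℕ) (i : Fin (N - 1))
    (v : Fin N → R) (c : Fin N) : (v ᵥ* burauMatrixInv t' N i) c =
      if (c : ℕ) = i then v ⟨i + 1, by omega⟩
      else if (c : ℕ) = i + 1 then t' * v ⟨i, by omega⟩ + (1 - t') * v ⟨i + 1, by omega⟩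
      else v c := by
  have key : (fun r => burauMatrixInv t' N i r c) =
      if (c : ℕ) = i then Pi.single ⟨i + 1, by omega⟩ 1
      else if (c : ℕ) = i + 1 then
        t' • Pi.single ⟨i, by omega⟩ 1 + (1 - t') • Pi.single ⟨i + 1, by omega⟩ 1
      else Pi.single c 1 := by
    funext r
    simp only [burauMatrixInv]
    split_ifs <;> simp_all [Pi.single_apply, Fin.ext_iff]
  change v ⬝ᵥ (fun r => burauMatrixInv t' N i r c) = _
  rw [key]
  split_ifs <;> simp only [dotProduct_add, dotProduct_smul, dotProduct_single, mul_one, smul_eq_mul]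

/-- The Burau matrix of a letter of a braid word. -/
noncomputable def letterMatrix (t : ℂ) (N : ℕ) (g : Fin (N - 1) × Bool) :
    Matrix (Fin N) (Fin N) ℂ :=
  if g.2 then burauMatrix t N g.1 else burauMatrixInv t⁻¹ N g.1

noncomputable def wordMatrix (t : ℂ) (N : ℕ) (w : List (Fin (N - 1) × Bool)) :
    Matrix (Fin N) (Fin N) ℂ :=
  (w.map (letterMatrix t N)).prod

-- Labels below are means of labels above, so a crossing acts from top to bottom, by its Burau
-- matrix on row vectors. The downward strands of the closure pass by unchanged.
open Matrix in
theorem colors_braidSlice {t : ℂ} (ht : t ≠ 0) {N m : ℕ} (g : Fin (N - 1) × Bool) (f f' : ℕ → ℂ) :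
    (braidSlice N m g).Colors t (row f (N + m)) (row f' (N + m)) ↔
      (∀ j : Fin N, f j = ((fun j : Fin N => f' j) ᵥ* letterMatrix t N g) j) ∧
        ∀ p < m, f (N + p) = f' (N + p) := by
  obtain ⟨i, o⟩ := g
  obtain ⟨i, hi⟩ := i
  obtain ⟨k, rfl⟩ : ∃ k, N = i + (2 + k) := ⟨N - 2 - i, by omega⟩
  have hk : i + (2 + k) - 2 - i = k := by omega
  have e : (braidSlice (i + (2 + k)) m (⟨i, hi⟩, o)).Colors t (row f (i + (2 + k) + m))
      (row f' (i + (2 + k) + m)) ↔ (∀ p < i, f p = f' p) ∧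
        (f' i = crossLeft t true true o (f i) (f (i + 1)) ∧
          f' (i + 1) = crossRight t true true o (f i) (f (i + 1))) ∧
        ∀ p < k + m, f (i + (2 + p)) = f' (i + (2 + p)) := by
    rw [show i + (2 + k) + m = i + (2 + (k + m)) by ring]
    simp only [row_add, ← row_eq_row]
    constructor
    · rintro ⟨l, r, g, g', hl, hr, ⟨p, q, rfl, rfl⟩, hx, hy⟩
      simp only [braidSlice, List.length_replicate] at hl
      obtain ⟨h1, hx⟩ := List.append_inj hx (by rw [length_row, hl])
      obtain ⟨h2, h3⟩ := List.append_inj hx (by simp [length_row])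
      obtain ⟨h1', hy⟩ := List.append_inj hy (by rw [length_row, hl])
      obtain ⟨h2', h3'⟩ := List.append_inj hy (by simp [length_row])
      simp [row, List.range_succ] at h2 h2'
      obtain ⟨rfl, rfl⟩ := h2
      exact ⟨h1.trans h1'.symm, h2', h3.trans h3'.symm⟩
    · rintro ⟨h1, h2, h3⟩
      refine ⟨_, _, [f i, f (i + 1)], [f' i, f' (i + 1)], ?_, ?_,
        ⟨f i, f (i + 1), rfl, by rw [← h2.1, ← h2.2]⟩, rfl, by rw [h1, h3]; rfl⟩
      · simp [length_row, braidSlice]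
      · simp [length_row, braidSlice, hk]
  rw [e]
  have e' : (∀ j : Fin (i + (2 + k)), f j =
      ((fun j : Fin (i + (2 + k)) => f' j) ᵥ* letterMatrix t (i + (2 + k)) (⟨i, hi⟩, o)) j) ↔
      (∀ p < i, f p = f' p) ∧ (f' i = crossLeft t true true o (f i) (f (i + 1)) ∧
          f' (i + 1) = crossRight t true true o (f i) (f (i + 1))) ∧
        ∀ p < k, f (i + (2 + p)) = f' (i + (2 + p)) := by
    cases o
    · simp only [letterMatrix, Bool.false_eq_true, if_false, vecMul_burauMatrixInv]
      constructor
      · intro H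
        have h0 := H ⟨i, by omega⟩
        have h1 := H ⟨i + 1, by omega⟩
        simp at h0 h1
        refine ⟨fun p hp => ?_, ⟨?_, ?_⟩, fun p hp => ?_⟩
        · have h := H ⟨p, by omega⟩
          rwa [if_neg (by dsimp only; omega), if_neg (by dsimp only; omega)] at h
        · simp [crossLeft]; grind
        · simp [crossRight, h0]
        · have h := H ⟨i + (2 + p), by omega⟩
          rwa [if_neg (by dsimp only; omega), if_neg (by dsimp only; omega)] at h
      · rintro ⟨h1, ⟨h2, h3⟩, h4⟩ ⟨j, hj⟩
        simp [crossLeft, crossRight] at h2 h3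
        simp only
        split_ifs with c1 c2
        · rw [c1, h3]
        · rw [c2, h2, h3]; field_simp; ring
        · rcases Nat.lt_or_ge j i with hj' | hj'
          · exact h1 j hj'
          · obtain ⟨p, rfl⟩ := Nat.exists_eq_add_of_le (by omega : i + 2 ≤ j)
            simpa [Nat.add_assoc] using h4 p (by omega)
    · simp only [letterMatrix, if_true, vecMul_burauMatrix]
      constructor
      · intro H
        have h0 := H ⟨i, by omega⟩
        have h1 := H ⟨i + 1, by omega⟩
        simp at h0 h1
        refine ⟨fun p hp => ?_, ⟨?_, ?_⟩, fun p hp => ?_⟩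
        · have h := H ⟨p, by omega⟩
          rwa [if_neg (by dsimp only; omega), if_neg (by dsimp only; omega)] at h
        · simp [crossLeft, h1]
        · simp [crossRight]; grind
        · have h := H ⟨i + (2 + p), by omega⟩
          rwa [if_neg (by dsimp only; omega), if_neg (by dsimp only; omega)] at h
      · rintro ⟨h1, ⟨h2, h3⟩, h4⟩ ⟨j, hj⟩
        simp [crossLeft, crossRight] at h2 h3
        simp only
        split_ifs with c1 c2
        · rw [c1, h2, h3]; field_simp; ring
        · rw [c2, h2]
        · rcases Nat.lt_or_ge j i with hj' | hj'
          · exact h1 j hj'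
          · obtain ⟨p, rfl⟩ := Nat.exists_eq_add_of_le (by omega : i + 2 ≤ j)
            simpa [Nat.add_assoc] using h4 p (by omega)
  rw [e']
  constructor
  · rintro ⟨h1, h2, h3⟩
    exact ⟨⟨h1, h2, fun p hp => h3 p (by omega)⟩,
      fun p hp => by simpa [Nat.add_assoc] using h3 (k + p) (by omega)⟩
  · rintro ⟨⟨h1, h2, h3⟩, h4⟩
    refine ⟨h1, h2, fun p hp => ?_⟩
    rcases Nat.lt_or_ge p k with hp' | hp'
    · exact h3 p hp'
    · obtain ⟨q, rfl⟩ := Nat.exists_eq_add_of_le hp'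
      simpa [Nat.add_assoc] using h4 q (by omega)

-- The first letter is the highest crossing and is the first to act on the top row, which agrees
-- with the order of factors when a product acts on row vectors.
open Matrix in
theorem colored_braid {t : ℂ} (ht : t ≠ 0) {N m : ℕ} (w : List (Fin (N - 1) × Bool))
    (f f' : ℕ → ℂ) :
    (∃ tr, Colored t (w.reverse.map (braidSlice N m)) (row f (N + m)) (row f' (N + m)) tr) ↔
      (∀ j : Fin N, f j = ((fun j : Fin N => f' j) ᵥ* wordMatrix t N w) j) ∧
        ∀ p < m, f (N + p) = f' (N + p) := by
  induction w generalizing f' with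
  | nil =>
    simp only [List.reverse_nil, List.map_nil, Colored, exists_and_left, exists_eq, and_true,
      row_eq_row, wordMatrix, List.prod_nil, Matrix.vecMul_one]
    constructor
    · intro H
      exact ⟨fun j => H j (by omega), fun p hp => H _ (by omega)⟩
    · rintro ⟨h1, h2⟩ p hp
      rcases Nat.lt_or_ge p N with hp' | hp'
      · exact h1 ⟨p, hp'⟩
      · obtain ⟨q, rfl⟩ := Nat.exists_eq_add_of_le hp'
        exact h2 q (by omega)
  | cons g w ih =>
    simp only [List.reverse_cons, List.map_append, List.map_cons, List.map_nil, colored_append]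
    have e : wordMatrix t N (g :: w) = letterMatrix t N g * wordMatrix t N w := by
      simp [wordMatrix]
    rw [e, ← Matrix.vecMul_vecMul]
    constructor
    · rintro ⟨_, z, tr₁, _, h1, ⟨_, _, h2, ⟨rfl, rfl⟩, rfl⟩, rfl⟩
      have hz : z.length = N + m := by
        rw [h2.length_dom, ← h2.length_cod.symm.trans (length_row _ _)]
        simp [Slice.dom, Slice.cod, braidSlice, Gen.dom, Gen.cod]
      obtain ⟨f₁, rfl⟩ : ∃ f₁, z = row f₁ (N + m) := ⟨_, by rw [← hz]; exact (row_getD z).symm⟩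
      obtain ⟨a1, a2⟩ := (ih f₁).1 ⟨_, h1⟩
      obtain ⟨b1, b2⟩ := (colors_braidSlice ht g f₁ f').1 h2
      refine ⟨fun j => ?_, fun p hp => (a2 p hp).trans (b2 p hp)⟩
      rw [a1 j]
      congr 2
      funext j
      exact b1 j
    · rintro ⟨h1, h2⟩
      -- The row just below the highest crossing `g`.
      let f₁ : ℕ → ℂ := fun p => if hp : p < N then
        ((fun j : Fin N => f' j) ᵥ* letterMatrix t N g) ⟨p, hp⟩ else f' p
      have hf₁ : (fun j : Fin N => f₁ j) = (fun j : Fin N => f' j) ᵥ* letterMatrix t N g := by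
        funext j
        simp [f₁]
      have hf₂ : ∀ p, f₁ (N + p) = f' (N + p) := fun p => by simp [f₁]
      obtain ⟨tr, h⟩ := (ih f₁).2 ⟨by rwa [hf₁], fun p hp => (h2 p hp).trans (hf₂ p).symm⟩
      exact ⟨_, _, _, _, h, ⟨_, _, (colors_braidSlice ht g f₁ f').2
        ⟨fun j => congrFun hf₁ j, fun p _ => hf₂ p⟩, ⟨rfl, rfl⟩, rfl⟩, rfl⟩

/-- The minima are nested, so the labels `ys` of the arcs come back in reverse order on the downward
strands. -/
theorem colored_cups {t : ℂ} {n m : ℕ} {x z : List ℂ} (hx : x.length = n) :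
    (∃ tr, Colored t (closureCups n m) x z tr) ↔
      ∃ ys : List ℂ, ys.length = m ∧ z = x ++ (ys ++ ys.reverse) := by
  induction m generalizing z with
  | zero => simp [closureCups, Colored, eq_comm]
  | succ m ih =>
    simp only [closureCups, colored_append]
    constructor
    · rintro ⟨_, z', tr₁, _, h1, ⟨_, _, ⟨l, r, _, _, hl, hr, ⟨rfl, u, rfl⟩, hz, rfl⟩, ⟨rfl, rfl⟩,
        rfl⟩, rfl⟩
      obtain ⟨ys, hys, rfl⟩ := ih.1 ⟨_, h1⟩
      simp only [List.length_replicate] at hl hr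
      rw [List.nil_append, ← List.append_assoc] at hz
      obtain ⟨rfl, rfl⟩ := List.append_inj hz (by simp [hx, hys, hl])
      exact ⟨ys ++ [u], by simp [hys], by simp⟩
    · rintro ⟨ys', hys', rfl⟩
      obtain ⟨ys, u', rfl, hys, hu⟩ := exists_append_of_length_eq hys'
      obtain ⟨u, rfl⟩ := List.length_eq_one_iff.1 hu
      obtain ⟨tr, h⟩ := ih.2 ⟨ys, hys, rfl⟩
      refine ⟨_, _, _, _, h, ⟨_, _, ⟨x ++ ys, ys.reverse, [], [u, u], ?_, ?_, ⟨rfl, u, rfl⟩, ?_,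
        rfl⟩, ⟨?_, rfl⟩, rfl⟩, rfl⟩
      · simp [hx, hys]
      · simp [hys]
      · simp
      · simp

theorem colored_caps {t : ℂ} {n m : ℕ} {y z : List ℂ} (hz : z.length = n + (m + m)) :
    (∃ tr, Colored t (closureCaps n m) z y tr) ↔
      ∃ ys : List ℂ, ys.length = m ∧ y.length = n ∧ z = y ++ (ys ++ ys.reverse) := by
  induction m generalizing z with
  | zero =>
    simp [closureCaps, Colored]
    rintro rfl
    simpa using hz
  | succ m ih =>
    simp only [closureCaps, Colored]
    constructor
    · rintro ⟨_, z', tr', ⟨l, r, _, _, hl, hr, ⟨rfl, u, rfl⟩, rfl, rfl⟩, h, rfl⟩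
      simp only [List.length_replicate] at hl hr
      obtain ⟨ys, hys, hy, hz'⟩ := (ih (by simp [hl, hr]; omega)).1 ⟨_, h⟩
      rw [List.nil_append, ← List.append_assoc] at hz'
      obtain ⟨rfl, rfl⟩ := List.append_inj hz' (by simp [hy, hys, hl])
      exact ⟨ys ++ [u], by simp [hys], hy, by simp⟩
    · rintro ⟨ys', hys', hy, rfl⟩
      obtain ⟨ys, u', rfl, hys, hu⟩ := exists_append_of_length_eq hys'
      obtain ⟨u, rfl⟩ := List.length_eq_one_iff.1 hu
      obtain ⟨tr, h⟩ := (ih (z := y ++ (ys ++ ys.reverse)) (by simp [hy, hys])).2 ⟨ys, hys, hy, rfl⟩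
      rw [← List.append_assoc] at h
      refine ⟨_, _, tr, ⟨y ++ ys, ys.reverse, [u, u], [], ?_, ?_, ⟨rfl, u, rfl⟩, ?_, rfl⟩, h, rfl⟩
      · simp [hy, hys]
      · simp [hys]
      · simp

/-- The colourings of a closed braid diagram above the minima. -/
theorem colored_braid_caps {t : ℂ} (ht : t ≠ 0) {n m : ℕ} (w : List (Fin (n + m - 1) × Bool))
    (x y : Fin n → ℂ) (c : Fin m → ℂ) {X : Matrix (Fin n) (Fin n) ℂ} {Y : Matrix (Fin n) (Fin m) ℂ}
    {Z : Matrix (Fin m) (Fin n) ℂ} {Q : Matrix (Fin m) (Fin m) ℂ}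
    (hM : (wordMatrix t (n + m) w).submatrix finSumFinEquiv finSumFinEquiv =
      Matrix.fromBlocks X Y Z Q) :
    (∃ tr, Colored t (w.reverse.map (braidSlice (n + m) m) ++ closureCaps n m)
      (List.ofFn x ++ (List.ofFn c ++ (List.ofFn c).reverse)) (List.ofFn y) tr) ↔
      x = Matrix.vecMul y X + Matrix.vecMul c Z ∧ c = Matrix.vecMul y Y + Matrix.vecMul c Q := by
  have conv : ∀ (a : Fin n → ℂ) (b d : Fin m → ℂ), ∃ f : ℕ → ℂ,
      List.ofFn a ++ (List.ofFn b ++ (List.ofFn d).reverse) = row f (n + m + m) ∧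
      (∀ s, f (finSumFinEquiv s : Fin (n + m)) = Sum.elim a b s) ∧
      ∀ p (hp : p < m), f (n + m + p) = d ⟨m - 1 - p, by omega⟩ := by
    intro a b d
    have hl : (List.ofFn a ++ (List.ofFn b ++ (List.ofFn d).reverse)).length = n + m + m := by
      simp [Nat.add_assoc]
    refine ⟨_, by rw [← hl]; exact (row_getD _).symm, ?_, ?_⟩
    · rintro (i | i)
      · simp [List.getElem?_append]
      · simp [List.getElem?_append]
    · intro p hp
      simp [Nat.add_assoc, hp]
  -- Here `d` labels the last `m` upward strands at the top of the braid and, through the maxima,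
  -- the downward strands. These carry `c` up from the minima, whence `c = d`.
  have key : ∀ d : Fin m → ℂ,
      (∃ tr, Colored t (w.reverse.map (braidSlice (n + m) m))
        (List.ofFn x ++ (List.ofFn c ++ (List.ofFn c).reverse))
        (List.ofFn y ++ (List.ofFn d ++ (List.ofFn d).reverse)) tr) ↔
      (x = Matrix.vecMul y X + Matrix.vecMul d Z ∧ c = Matrix.vecMul y Y + Matrix.vecMul d Q) ∧
        c = d := by
    intro d
    obtain ⟨f, hf, hf1, hf2⟩ := conv x c c
    obtain ⟨f', hf', hf1', hf2'⟩ := conv y d d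
    rw [hf, hf', colored_braid ht]
    refine and_congr ?_ ?_
    · have e : (fun j : Fin (n + m) => f' j) ∘ finSumFinEquiv = Sum.elim y d := by
        funext s; exact hf1' s
      rw [← finSumFinEquiv.forall_congr_right]
      have e2 : ∀ s, (Matrix.vecMul (fun j : Fin (n + m) => f' j) (wordMatrix t (n + m) w))
          (finSumFinEquiv s) = (Sum.elim (Matrix.vecMul y X + Matrix.vecMul d Z)
            (Matrix.vecMul y Y + Matrix.vecMul d Q)) s := by
        intro s
        have e3 : Sum.elim (Matrix.vecMul y X + Matrix.vecMul d Z)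
            (Matrix.vecMul y Y + Matrix.vecMul d Q) =
            Matrix.vecMul (Sum.elim y d) (Matrix.fromBlocks X Y Z Q) := by
          rw [Matrix.vecMul_fromBlocks, Sum.elim_comp_inl, Sum.elim_comp_inr]
        rw [e3, ← e, ← hM, Matrix.submatrix_vecMul_equiv]
        simp [Function.comp_def]
      simp only [hf1, e2]
      rw [← funext_iff]
      constructor
      · intro h
        exact ⟨by funext i; exact congrFun h (.inl i), by funext i; exact congrFun h (.inr i)⟩
      · rintro ⟨h1, h2⟩
        rw [← h1, ← h2]
    · constructor
      · intro H
        funext ⟨i, hi⟩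
        have := H (m - 1 - i) (by omega)
        rw [hf2 _ (by omega), hf2' _ (by omega)] at this
        simpa [(by omega : m - 1 - (m - 1 - i) = i)] using this
      · rintro rfl p hp
        rw [hf2 p hp, hf2' p hp]
  simp only [colored_append]
  constructor
  · rintro ⟨_, z, tr₁, tr₂, h1, h2, rfl⟩
    have hz : z.length = n + (m + m) := by
      rw [h1.length_eq (composable_braid (n + m) m w.reverse) (by simp [Nat.add_assoc])]
      simp [Nat.add_assoc]
    obtain ⟨ys, hys, -, rfl⟩ := (colored_caps hz).1 ⟨_, h2⟩
    subst hys
    obtain ⟨h, h'⟩ := (key ys.get).1 ⟨tr₁, by simpa [List.ofFn_get] using h1⟩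
    rwa [← h'] at h
  · intro h
    obtain ⟨tr₁, h1⟩ := (key c).2 ⟨h, rfl⟩
    obtain ⟨tr₂, h2⟩ := (colored_caps (t := t) (n := n) (m := m) (y := List.ofFn y)
      (z := List.ofFn y ++ (List.ofFn c ++ (List.ofFn c).reverse)) (by simp)).2
      ⟨List.ofFn c, by simp, by simp, rfl⟩
    exact ⟨_, _, _, _, h1, h2, rfl⟩

/-- The labels `c` of the closing arcs are the unknowns to be eliminated. One implication is enough,
because the existence of colourings comes from the path sums. -/
theorem colored_closure {t : ℂ} (ht : t ≠ 0) {n m : ℕ} (w : List (Fin (n + m - 1) × Bool))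
    (x y : Fin n → ℂ) {X : Matrix (Fin n) (Fin n) ℂ} {Y : Matrix (Fin n) (Fin m) ℂ}
    {Z : Matrix (Fin m) (Fin n) ℂ} {Q : Matrix (Fin m) (Fin m) ℂ}
    (hM : (wordMatrix t (n + m) w).submatrix finSumFinEquiv finSumFinEquiv =
      Matrix.fromBlocks X Y Z Q)
    (h : ∃ tr, Colored t (closureDiagram n m w).word (List.ofFn x) (List.ofFn y) tr) :
    ∃ c, x = Matrix.vecMul y X + Matrix.vecMul c Z ∧
      c = Matrix.vecMul y Y + Matrix.vecMul c Q := by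
  obtain ⟨tr, h⟩ := h
  simp only [closureDiagram, List.append_assoc] at h
  obtain ⟨z, tr₁, tr₂, h1, h2, -⟩ := colored_append.1 h
  obtain ⟨ys, hys, rfl⟩ := (colored_cups (by simp)).1 ⟨_, h1⟩
  subst hys
  exact ⟨ys.get, (colored_braid_caps ht w x y ys.get hM).1 ⟨tr₂, by simpa [List.ofFn_get] using h2⟩⟩

/-- A vector with `c = c Q` labels the closing arcs of a colouring at `t = 1` with bottom row `c Z`
and top row `0`, so rigidity forces `c = 0`. -/
theorem det_ne_zero_of_rigid {n m : ℕ} {w : List (Fin (n + m - 1) × Bool)}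
    (hr : Rigid (pos n) (closureDiagram n m w).word) {X : Matrix (Fin n) (Fin n) ℂ}
    {Y : Matrix (Fin n) (Fin m) ℂ} {Z : Matrix (Fin m) (Fin n) ℂ} {Q : Matrix (Fin m) (Fin m) ℂ}
    (hM : (wordMatrix 1 (n + m) w).submatrix finSumFinEquiv finSumFinEquiv =
      Matrix.fromBlocks X Y Z Q) : (1 - Q).det ≠ 0 := by
  intro hdet
  obtain ⟨c, hc0, hc⟩ := Matrix.exists_vecMul_eq_zero_iff.2 hdet
  rw [Matrix.vecMul_sub, Matrix.vecMul_one, sub_eq_zero] at hc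
  obtain ⟨tr₂, h2⟩ := (colored_braid_caps one_ne_zero w (Matrix.vecMul c Z) 0 c hM).2
    ⟨by simp, by simpa using hc⟩
  obtain ⟨tr₁, h1⟩ := (colored_cups (t := 1) (n := n) (m := m)
    (x := List.ofFn (Matrix.vecMul c Z)) (by simp)).2 ⟨List.ofFn c, by simp, rfl⟩
  have zero : IsZeroRow (List.ofFn (0 : Fin n → ℂ)) := by
    intro u hu
    obtain ⟨i, rfl⟩ := (List.mem_ofFn' _ _).1 hu
    rfl
  have key := hr (List.ofFn (Matrix.vecMul c Z)) (List.ofFn 0) (tr₁ ++ tr₂) (by simp) (by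
    simp only [closureDiagram, List.append_assoc]
    exact colored_append.2 ⟨_, _, _, h1, h2, rfl⟩) zero
  have hz := h2.isZeroRow_bottom zero fun z hz => key z (by simp [hz])
  refine hc0 (funext fun i => hz _ ?_)
  simp only [List.mem_append]
  exact .inr (.inl ((List.mem_ofFn' _ _).2 ⟨i, rfl⟩))

/-! ### Evaluation of Laurent polynomials and rational functions -/

noncomputable def evalLaurent (t : ℂˣ) : ℤ[T;T⁻¹] →+* ℂ :=
  LaurentPolynomial.eval₂ (Int.castRingHom ℂ) t

/-- `RatFunc.eval` uses the reduced fraction. If its denominator vanished at `a`, then so would its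
numerator, because `q` does not, contrary to coprimality. -/
theorem eval_ratFunc_eq_div {K L : Type} [Field K] [Field L] (f : K →+* L) (a : L)
    {r : RatFunc K} {p q : Polynomial K} (hq : q.eval₂ f a ≠ 0)
    (h : r * algebraMap _ (RatFunc K) q = algebraMap _ (RatFunc K) p) :
    RatFunc.eval f a r = p.eval₂ f a / q.eval₂ f a := by
  have hd0 : algebraMap _ (RatFunc K) r.denom ≠ 0 := by
    simpa using r.denom_ne_zero
  have hpoly : r.num * q = p * r.denom := by
    apply IsFractionRing.injective (Polynomial K) (RatFunc K)
    rw [map_mul, map_mul, ← h, mul_right_comm, (div_eq_iff hd0).1 r.num_div_denom]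
  have he := congrArg (Polynomial.eval₂ f a) hpoly
  rw [Polynomial.eval₂_mul, Polynomial.eval₂_mul] at he
  have hd : r.denom.eval₂ f a ≠ 0 := by
    intro hd
    rw [hd, mul_zero] at he
    have hn := (mul_eq_zero.1 he).resolve_right hq
    obtain ⟨u, v, huv⟩ := r.isCoprime_num_denom
    have := congrArg (Polynomial.eval₂ f a) huv
    simp [Polynomial.eval₂_add, Polynomial.eval₂_mul, hn, hd] at this
  rw [RatFunc.eval, div_eq_div_iff hd hq, he]

/-- A power of `t` clears the negative exponents. The same `P` controls the complex values and the
image in `ℚ(t)`, which links the two. -/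
theorem exists_laurent_polynomial (p : ℤ[T;T⁻¹]) : ∃ (k : ℕ) (P : Polynomial ℤ),
    (∀ t : ℂˣ, evalLaurent t p * (t : ℂ) ^ k = P.eval₂ (Int.castRingHom ℂ) t) ∧
    laurentToRatFunc p * RatFunc.X ^ k =
      algebraMap _ (RatFunc ℚ) (P.map (Int.castRingHom ℚ)) := by
  obtain ⟨k, P, hP⟩ := p.exists_T_pow
  refine ⟨k, P, fun t => ?_, ?_⟩
  · rw [← LaurentPolynomial.eval₂_toLaurent, hP, map_mul, LaurentPolynomial.eval₂_T_n]
    rfl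
  · have h : laurentToRatFunc (Polynomial.toLaurent P) =
        Polynomial.eval₂ (Int.castRingHom (RatFunc ℚ)) RatFunc.X P :=
      LaurentPolynomial.eval₂_toLaurent _ _ _
    rw [hP, map_mul] at h
    have h2 : laurentToRatFunc (LaurentPolynomial.T k) = RatFunc.X ^ k :=
      LaurentPolynomial.eval₂_T_n _ _ _
    rw [h2] at h
    have e : ((algebraMap (Polynomial ℚ) (RatFunc ℚ)).comp
        (Polynomial.mapRingHom (Int.castRingHom ℚ))) =
        Polynomial.eval₂RingHom (Int.castRingHom (RatFunc ℚ)) RatFunc.X := by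
      ext
      · simp
      · simp
    rw [h]
    exact (congrArg (fun f : Polynomial ℤ →+* RatFunc ℚ => f P) e).symm

theorem eval_eq_evalLaurent_div (t : ℂˣ) {r : RatFunc ℚ} {p q : ℤ[T;T⁻¹]}
    (hq : evalLaurent t q ≠ 0) (h : r * laurentToRatFunc q = laurentToRatFunc p) :
    RatFunc.eval (algebraMap ℚ ℂ) t r = evalLaurent t p / evalLaurent t q := by
  obtain ⟨k, P, hP, hP'⟩ := exists_laurent_polynomial p
  obtain ⟨l, Q, hQ, hQ'⟩ := exists_laurent_polynomial q
  have ht : (t : ℂ) ≠ 0 := t.ne_zero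
  have ev : ∀ P : Polynomial ℤ, ((P.map (Int.castRingHom ℚ)).eval₂ (algebraMap ℚ ℂ) (t : ℂ)) =
      P.eval₂ (Int.castRingHom ℂ) t := by
    intro P
    rw [Polynomial.eval₂_map]
    congr 1
  rw [eval_ratFunc_eq_div (algebraMap ℚ ℂ) (t : ℂ) (p := P.map (Int.castRingHom ℚ) * .X ^ l)
    (q := Q.map (Int.castRingHom ℚ) * .X ^ k)]
  · simp only [Polynomial.eval₂_mul, Polynomial.eval₂_X_pow, ev, ← hP, ← hQ]
    field_simp
  · simp only [Polynomial.eval₂_mul, Polynomial.eval₂_X_pow, ev, ← hQ]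
    exact mul_ne_zero (mul_ne_zero hq (pow_ne_zero _ ht)) (pow_ne_zero _ ht)
  · simp only [map_mul, map_pow, RatFunc.algebraMap_X, ← hP', ← hQ', ← h]
    ring

theorem laurentToRatFunc_ne_zero {t : ℂˣ} {p : ℤ[T;T⁻¹]} (hp : evalLaurent t p ≠ 0) :
    laurentToRatFunc p ≠ 0 := by
  intro h0
  obtain ⟨k, P, hP, hP'⟩ := exists_laurent_polynomial p
  rw [h0, zero_mul, eq_comm, map_eq_zero_iff _ (IsFractionRing.injective (Polynomial ℚ) (RatFunc ℚ)),
    Polynomial.map_eq_zero_iff (Int.cast_injective)] at hP'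
  have := hP t
  rw [hP', Polynomial.eval₂_zero] at this
  exact mul_ne_zero hp (pow_ne_zero _ t.ne_zero) this

theorem eventually_evalLaurent_ne_zero {p : ℤ[T;T⁻¹]} (hp : evalLaurent 1 p ≠ 0) :
    ∀ᶠ t in 𝓝 (1 : ℂ), ∀ u : ℂˣ, (u : ℂ) = t → evalLaurent u p ≠ 0 := by
  obtain ⟨k, P, hP, -⟩ := exists_laurent_polynomial p
  have hc : Continuous fun t : ℂ => P.eval₂ (Int.castRingHom ℂ) t := by
    simp only [Polynomial.eval₂_eq_eval_map]
    exact Polynomial.continuous _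
  have h1 : P.eval₂ (Int.castRingHom ℂ) (1 : ℂ) ≠ 0 := by
    have := hP 1
    rw [Units.val_one, one_pow, mul_one] at this
    rwa [← this]
  filter_upwards [hc.continuousAt.eventually_ne h1] with t ht u hu h0
  have := hP u
  rw [h0, zero_mul, hu] at this
  exact ht this.symm

theorem ratFunc_eq_of_eventually_eval_eq {r r' : RatFunc ℚ}
    (h : ∀ᶠ t in 𝓝 (1 : ℂ), RatFunc.eval (algebraMap ℚ ℂ) t r =
      RatFunc.eval (algebraMap ℚ ℂ) t r') : r = r' := by
  -- The factor `r.denom * r'.denom` makes `p` vanish also at the poles, where `RatFunc.eval` has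
  -- the default value `0` and carries no information.
  let p : Polynomial ℚ := (r.num * r'.denom - r'.num * r.denom) * (r.denom * r'.denom)
  have hp : ∀ᶠ t in 𝓝 (1 : ℂ), (p.map (algebraMap ℚ ℂ)).IsRoot t := by
    filter_upwards [h] with t ht
    rw [Polynomial.IsRoot, ← Polynomial.eval₂_eq_eval_map]
    simp only [p, Polynomial.eval₂_mul, Polynomial.eval₂_sub]
    by_cases h1 : r.denom.eval₂ (algebraMap ℚ ℂ) t = 0
    · simp [h1]
    by_cases h2 : r'.denom.eval₂ (algebraMap ℚ ℂ) t = 0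
    · simp [h2]
    rw [RatFunc.eval, RatFunc.eval, div_eq_div_iff h1 h2] at ht
    rw [ht, sub_self, zero_mul]
  have hp0 : p.map (algebraMap ℚ ℂ) = 0 :=
    Polynomial.eq_zero_of_infinite_isRoot _ (infinite_of_mem_nhds 1 hp)
  rw [Polynomial.map_eq_zero] at hp0
  have h3 := (mul_eq_zero.1 hp0).resolve_right (mul_ne_zero r.denom_ne_zero r'.denom_ne_zero)
  have hd : algebraMap (Polynomial ℚ) (RatFunc ℚ) r.denom ≠ 0 := by simpa using r.denom_ne_zero
  have hd' : algebraMap (Polynomial ℚ) (RatFunc ℚ) r'.denom ≠ 0 := by simpa using r'.denom_ne_zero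
  rw [← r.num_div_denom, ← r'.num_div_denom, div_eq_div_iff hd hd', ← map_mul, ← map_mul,
    sub_eq_zero.1 h3]

/-! ### The Burau matrix of a word -/

theorem burauMatrix_map {R S : Type*} [CommRing R] [CommRing S] (φ : R →+* S) (t : R) (N : ℕ)
    (i : Fin (N - 1)) : (burauMatrix t N i).map φ = burauMatrix (φ t) N i := by
  ext r c
  simp only [burauMatrix, Matrix.map_apply]
  split_ifs <;> simp

theorem burauMatrixInv_map {R S : Type*} [CommRing R] [CommRing S] (φ : R →+* S) (t : R) (N : ℕ)
    (i : Fin (N - 1)) : (burauMatrixInv t N i).map φ = burauMatrixInv (φ t) N i := by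
  ext r c
  simp only [burauMatrixInv, Matrix.map_apply]
  split_ifs <;> simp

theorem burau_map_evalLaurent (t : ℂˣ) (N : ℕ) (w : List (Fin (N - 1) × Bool)) :
    (burau N (braidOfWord N w)).1.map (evalLaurent t) = wordMatrix t N w := by
  have h : burau N (braidOfWord N w) = FreeGroup.lift (burauUnit laurentT N) (FreeGroup.mk w) := rfl
  rw [h, FreeGroup.lift_mk]
  have hT : evalLaurent t (laurentT : ℤ[T;T⁻¹]) = t := by
    simp [evalLaurent, laurentT]
  have hT' : evalLaurent t ((laurentT⁻¹ : ℤ[T;T⁻¹]ˣ) : ℤ[T;T⁻¹]) = (t : ℂ)⁻¹ := by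
    simp [evalLaurent, laurentT]
  induction w with
  | nil => simp [wordMatrix, Matrix.map_one]
  | cons g w ih =>
    have e : wordMatrix t N (g :: w) = letterMatrix t N g * wordMatrix t N w := by
      simp [wordMatrix]
    rw [e, ← ih rfl, List.map_cons, List.prod_cons, Units.val_mul, Matrix.map_mul]
    congr 1
    obtain ⟨i, o⟩ := g
    cases o
    · change (burauMatrixInv _ N i).map _ = _
      rw [burauMatrixInv_map, hT']
      simp [letterMatrix]
    · change (burauMatrix _ N i).map _ = _
      rw [burauMatrix_map, hT]
      simp [letterMatrix]

-- Multiplication by the determinant turns the inverse into an adjugate, and ring homomorphisms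
-- commute with the result. Taking for `φ` both the embedding into `ℚ(t)` and the evaluation at a
-- number compares the two Schur complements.
open Matrix in
theorem schur_mul_det {R F : Type*} [CommRing R] [Field F] (φ : R →+* F) {n m : ℕ}
    (X : Matrix (Fin n) (Fin n) R) (Y : Matrix (Fin n) (Fin m) R)
    (Z : Matrix (Fin m) (Fin n) R) (Q : Matrix (Fin m) (Fin m) R) (hd : φ (1 - Q).det ≠ 0)
    (i j : Fin n) :
    (X.map φ + Y.map φ * (1 - Q.map φ)⁻¹ * Z.map φ) i j * φ (1 - Q).det =
      φ (((1 - Q).det • X + Y * (1 - Q).adjugate * Z) i j) := by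
  have h1 : (1 - Q.map φ) = (1 - Q).map φ := by
    rw [Matrix.map_sub _ (map_sub φ), Matrix.map_one _ (map_zero φ) (map_one φ)]
  have h2 : ((1 - Q).map φ).det = φ (1 - Q).det := (RingHom.map_det φ _).symm
  have h3 : ((1 - Q).map φ).adjugate = (1 - Q).adjugate.map φ := (RingHom.map_adjugate φ _).symm
  rw [h1, Matrix.inv_def, h2, h3, Ring.inverse_eq_inv', Matrix.mul_smul, Matrix.smul_mul,
    ← Matrix.map_mul, ← Matrix.map_mul]
  simp only [Matrix.add_apply, Matrix.smul_apply, Matrix.map_apply, smul_eq_mul, map_add, map_mul]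
  field_simp

/-! ### Uniqueness of the walk matrix, and the bottom labels of a closed braid -/

theorem TangleDiagram.HasWalkMatrix.unique {n : ℕ} {D : TangleDiagram (pos n) (pos n)}
    {G G' : Matrix (Fin n) (Fin n) (RatFunc ℚ)} (h : D.HasWalkMatrix G)
    (h' : D.HasWalkMatrix G') : G = G' := by
  ext j i
  apply ratFunc_eq_of_eventually_eval_eq
  filter_upwards [h, h'] with t ht ht'
  exact (ht i j).unique (ht' i j)

theorem StringLink.walkMatrix_eq {n : ℕ} (T : StringLink n)
    {G : Matrix (Fin n) (Fin n) (RatFunc ℚ)} (h : ∀ D, T.IsDiagram D → D.HasWalkMatrix G) :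
    T.walkMatrix = G := by
  have hG : ∃ G : Matrix (Fin n) (Fin n) (RatFunc ℚ), ∀ D, T.IsDiagram D → D.HasWalkMatrix G :=
    ⟨G, h⟩
  obtain ⟨D, hD, -⟩ := T.2
  rw [walkMatrix, dif_pos hG]
  exact (hG.choose_spec D hD).unique (h D hD)

/-- Only one diagram of `T` is known to consist of intervals; its rigidity is carried to all the
others by the moves. -/
theorem StringLink.IsDiagram.rigid {n : ℕ} {T : StringLink n} {D : TangleDiagram (pos n) (pos n)}
    (hD : T.IsDiagram D) : Rigid (pos n) D.word := by
  obtain ⟨D₁, h₁, hs⟩ := T.2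
  exact (TangleDiagram.invariant_of_toTangle_eq (h₁.trans hD.symm)).1.1 hs.rigid

/-- The bottom colors of a colored braid closure are given by the Schur complement. -/
theorem getD_eq_of_colored_closure {t : ℂ} (ht : t ≠ 0) {n m : ℕ}
    (w : List (Fin (n + m - 1) × Bool)) {x : List ℂ} (hx : x.length = n) (j i : Fin n)
    {X : Matrix (Fin n) (Fin n) ℂ} {Y : Matrix (Fin n) (Fin m) ℂ}
    {Z : Matrix (Fin m) (Fin n) ℂ} {Q : Matrix (Fin m) (Fin m) ℂ} (hQ : (1 - Q).det ≠ 0)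
    (hM : (wordMatrix t (n + m) w).submatrix finSumFinEquiv finSumFinEquiv =
      Matrix.fromBlocks X Y Z Q)
    (h : ∃ tr, Colored t (closureDiagram n m w).word x (TangleDiagram.unitRow n j) tr) :
    x.getD i 0 = (X + Y * (1 - Q)⁻¹ * Z) j i := by
  obtain ⟨x, rfl⟩ : ∃ x' : Fin n → ℂ, x = List.ofFn x' := by
    subst hx
    exact ⟨x.get, (List.ofFn_get x).symm⟩
  have e : TangleDiagram.unitRow n j = List.ofFn (Pi.single j 1 : Fin n → ℂ) := by
    apply List.ext_getElem
    · simp [TangleDiagram.unitRow, length_row]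
    · intro k h1 h2
      simp [TangleDiagram.unitRow, row, Pi.single_apply, Fin.ext_iff]
  rw [e] at h
  obtain ⟨c, hx, hc⟩ := colored_closure ht w x _ hM h
  have hc' : Matrix.vecMul c (1 - Q) = Matrix.vecMul (Pi.single j 1) Y := by
    rw [Matrix.vecMul_sub, Matrix.vecMul_one, sub_eq_iff_eq_add]
    exact hc
  have hc'' : c = Matrix.vecMul (Pi.single j 1) (Y * (1 - Q)⁻¹) := by
    rw [← Matrix.vecMul_vecMul, ← hc', Matrix.vecMul_vecMul,
      Matrix.mul_nonsing_inv _ (isUnit_iff_ne_zero.2 hQ), Matrix.vecMul_one]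
  have : x = Matrix.vecMul (Pi.single j 1) (X + Y * (1 - Q)⁻¹ * Z) := by
    rw [hx, hc'', Matrix.vecMul_vecMul, ← Matrix.vecMul_add]
  rw [Matrix.single_one_vecMul] at this
  simp [this, List.getD_eq_getElem?_getD]

end RandomWalk

/-! ### The proposition -/

open RandomWalk Filter Topology LaurentPolynomial in
theorem proposition2p4 (n m : ℕ) (T : RandomWalk.StringLink n) (b : RandomWalk.BraidGroup (n + m))
    (hT : T.IsClosureOf m b)
    (X : Matrix (Fin n) (Fin n) (RatFunc ℚ)) (Y : Matrix (Fin n) (Fin m) (RatFunc ℚ))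
    (Z : Matrix (Fin m) (Fin n) (RatFunc ℚ)) (Q : Matrix (Fin m) (Fin m) (RatFunc ℚ))
    (hb : (RandomWalk.burauRat (n + m) b).reindex finSumFinEquiv.symm finSumFinEquiv.symm =
      Matrix.fromBlocks X Y Z Q) :
    IsUnit (1 - Q) ∧
    (∀ D : RandomWalk.TangleDiagram (RandomWalk.pos n) (RandomWalk.pos n), T.IsDiagram D →
      D.HasWalkMatrix (X + Y * (1 - Q)⁻¹ * Z)) ∧
    T.walkMatrix = X + Y * (1 - Q)⁻¹ * Z := by
  obtain ⟨w, rfl, hD₀⟩ := hT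
  obtain ⟨X', Y', Z', Q', hB⟩ : ∃ X' Y' Z' Q', ((burau (n + m) (braidOfWord (n + m) w)).1.submatrix
      finSumFinEquiv finSumFinEquiv) = Matrix.fromBlocks X' Y' Z' Q' :=
    ⟨_, _, _, _, (Matrix.fromBlocks_toBlocks _).symm⟩
  have hmap (t : ℂˣ) : (wordMatrix t (n + m) w).submatrix finSumFinEquiv finSumFinEquiv =
      Matrix.fromBlocks (X'.map (evalLaurent t)) (Y'.map (evalLaurent t))
        (Z'.map (evalLaurent t)) (Q'.map (evalLaurent t)) := by
    rw [← burau_map_evalLaurent, Matrix.submatrix_map, hB, Matrix.fromBlocks_map]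
  have hdet (t : ℂˣ) : (1 - Q'.map (evalLaurent t)).det = evalLaurent t (1 - Q').det := by
    rw [RingHom.map_det, RingHom.mapMatrix_apply, Matrix.map_sub _ (map_sub _),
      Matrix.map_one _ (map_zero _) (map_one _)]
  -- Rigidity gives invertibility at `t = 1`. From there it spreads to `ℚ(t)` and to all `t` near
  -- `1`.
  have h1 : evalLaurent 1 (1 - Q').det ≠ 0 := by
    rw [← hdet]
    exact det_ne_zero_of_rigid hD₀.rigid (hmap 1)
  have hR := laurentToRatFunc_ne_zero h1
  rw [burauRat, Matrix.reindex_apply, Equiv.symm_symm, Matrix.submatrix_map, hB,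
    Matrix.fromBlocks_map, Matrix.fromBlocks_inj] at hb
  obtain ⟨rfl, rfl, rfl, rfl⟩ := hb
  have main : ∀ D : TangleDiagram (pos n) (pos n), T.IsDiagram D →
      D.HasWalkMatrix (X'.map laurentToRatFunc + Y'.map laurentToRatFunc *
        (1 - Q'.map laurentToRatFunc)⁻¹ * Z'.map laurentToRatFunc) := by
    intro D hD
    filter_upwards [TangleDiagram.eventually_hasSum hD.rigid, eventually_ne_nhds one_ne_zero,
      eventually_evalLaurent_ne_zero h1] with t ht ht0 hu i j
    obtain ⟨⟨x, tr, hx, hc⟩, hsum⟩ := ht j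
    have hu := hu (Units.mk0 t ht0) rfl
    -- The bottom row `x` of path sums in `D` also colours the closure diagram with the same unit
    -- top row, and there it can be computed.
    have hx' := getD_eq_of_colored_closure ht0 w hx j i (by rwa [hdet]) (hmap (Units.mk0 t ht0))
      (((TangleDiagram.invariant_of_toTangle_eq (hD.trans hD₀.symm)).2 t ht0 _ _
        (by simp [hx])).1 ⟨tr, hc⟩)
    -- Evaluation commutes with the inverse since `det (1 - Q')` does not vanish at `t`.
    have hval := eval_eq_evalLaurent_div (Units.mk0 t ht0) hu
      (schur_mul_det laurentToRatFunc X' Y' Z' Q' hR j i)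
    rw [← schur_mul_det (evalLaurent (Units.mk0 t ht0)) X' Y' Z' Q' hu j i,
      mul_div_cancel_right₀ _ hu, ← hx'] at hval
    rw [Units.val_mk0] at hval
    rw [hval]
    exact hsum x tr hx hc i
  refine ⟨?_, main, T.walkMatrix_eq main⟩
  rw [Matrix.isUnit_iff_isUnit_det, isUnit_iff_ne_zero]
  convert hR
  rw [RingHom.map_det, RingHom.mapMatrix_apply, Matrix.map_sub _ (map_sub _),
    Matrix.map_one _ (map_zero _) (map_one _)]
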